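/- Throughout, smooth means $C^\infty$, $\mathbb{S}^{n-1}$ is the unit sphere of $\mathbb{R}^n$, and sub-manifolds are embedded, without boundary unless stated otherwise, and may have components of different dimensions. Let $M=[0,\infty)\times\mathbb{S}^{n-1}$, a smooth manifold with boundary $\partial M=\{0\}\times\mathbb{S}^{n-1}$. A p-sub-manifold of an open subset $U$ of $M$ is a subset $N\subset U$ that is a smooth sub-manifold with boundary, such that $\partial N=N\cap\partial M$ and $T_pN+T_p\partial M=T_pM$ for every $p\in\partial N$. Let $X\subset\mathbb{R}^n$. A point $a \in X$ is a singular point of $X$ if $X$ is not a smooth sub-manifold near $a$; let $X_{\mathrm{sing}}$ be the set of singular points. A point $a\in X$ near which $X$ is closed is a conic point of $X$ if for some $r>0$ the closure in $[0,r)\times\mathbb{S}^{n-1}$ of $$\{(t,u): 0<t<r,\ u\in\mathbb{S}^{n-1},\ a+tu\in X\}$$ is a p-sub-manifold of $[0,r)\times\mathbb{S}^{n-1}$. Let $\overline{X}$ be the closure in $M$ of $\{(t,u): t>0,\ u\in\mathbb{S}^{n-1},\ t^{-1}u\in X\}$, and write $\overline{X}\cap\partial M=\{0\}\times X^\infty$.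 The set $X$ is conic at infinity if either $X$ is bounded, or $X^\infty\neq\emptyset$ and there is an open neighbourhood $W$ of $\{0\}\times X^\infty$ in $M$ such that $\overline{X}\cap W$ is a p-sub-manifold of $W$. The set $X$ is a conic singular sub-manifold of $\mathbb{R}^n$ if it is closed, $X_{\mathrm{sing}}$ is finite (possibly empty), every point of $X_{\mathrm{sing}}$ is a conic point of $X$, and $X$ is conic at infinity. For $x,x'\in X$ let $d_{\mathrm{inn}}^X(x,x')\in[0,\infty]$ be the infimum of the lengths of the rectifiable paths lying in $X$ that join $x$ to $x'$. The set $X$ is Lipschitz normally embedded (LNE) if there is a constant $L>0$ such that $d_{\mathrm{inn}}^X(x,x')\le L\,|x-x'|$ for all $x,x'\in X$. Theorem. Every connected conic singular sub-manifold $X$ of $\mathbb{R}^n$ is LNE. -/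

import Mathlib

open scoped ContDiff ENNReal

namespace ConicLNE

section InnerDistance

variable {E : Type*} [PseudoEMetricSpace E]

/-- The inner distance of `S`: the infimum of the lengths of the paths lying in `S` that join
`x` to `y`. Non-rectifiable paths have length `∞`, so they do not affect the infimum, which is
`∞` when no rectifiable path in `S` joins the two points. -/
noncomputable def innerDist (S : Set E) (x y : E) : ℝ≥0∞ :=
  ⨅ (γ : Path x y) (_ : Set.range γ ⊆ S), eVariationOn γ Set.univ

/-- `S` is Lipschitz normally embedded. -/
def IsLNE (S : Set E) : Prop :=
  ∃ L : NNReal, 0 < L ∧ ∀ x ∈ S, ∀ y ∈ S, innerDist S x y ≤ (L : ℝ≥0∞) * edist x y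

end InnerDistance

section Submanifolds

variable {F : Type*} [NormedAddCommGroup F] [NormedSpace ℝ F]

/-- `Φ` is a smooth diffeomorphism between open subsets of `F`. -/
def IsSmoothDiffeo (Φ : OpenPartialHomeomorph F F) : Prop :=
  ContDiffOn ℝ ∞ Φ Φ.source ∧ ContDiffOn ℝ ∞ Φ.symm Φ.target

/-- The germ of `N` at its point `p` is that of a smooth (embedded, boundaryless) sub-manifold:
some smooth chart of `F` around `p` straightens `N` to a linear subspace. The dimension may depend
on `p`. -/
def IsSmoothPoint (N : Set F) (p : F) : Prop :=
  ∃ (Φ : OpenPartialHomeomorph F F) (V : Submodule ℝ F),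
    IsSmoothDiffeo Φ ∧ p ∈ Φ.source ∧ ∀ x ∈ Φ.source, (x ∈ N ↔ Φ x ∈ V)

/-- The singular locus of `N`. -/
def singularLocus (N : Set F) : Set F := {p ∈ N | ¬ IsSmoothPoint N p}

/-- `Φ` is a smooth chart of `F` around `p` that straightens `N` to the closed half-space
`{v ∈ V | 0 ≤ ℓ v}` of the linear subspace `V`, sending `p` to a point of the boundary hyperplane:
near `p`, the set `N` is a smooth sub-manifold with boundary, and `p` is a boundary point. -/
structure IsBoundaryChart (N : Set F) (p : F) (Φ : OpenPartialHomeomorph F F)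
    (V : Submodule ℝ F) (ℓ : F →L[ℝ] ℝ) : Prop where
  smooth : IsSmoothDiffeo Φ
  mem_source : p ∈ Φ.source
  nondegenerate : ∃ v ∈ V, ℓ v ≠ 0
  boundary : ℓ (Φ p) = 0
  mem_iff : ∀ x ∈ Φ.source, (x ∈ N ↔ Φ x ∈ V ∧ 0 ≤ ℓ (Φ x))

end Submanifolds

section Conic

variable {E : Type*} [NormedAddCommGroup E] [InnerProductSpace ℝ E]

/-- `N` is a p-sub-manifold of (an open subset of) the manifold with boundary
`M = [0, ∞) × 𝕊`, with `𝕊` the unit sphere of `E`: `N` is a smooth sub-manifold with boundary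
whose boundary points are exactly its points in `∂M = {0} × 𝕊`, and at every such point
`p = (0, u)` it is transverse to the boundary, `T_p N + T_p ∂M = T_p M`. Here `T_p N` is the
preimage of `V` under the differential of the straightening chart, `T_p ∂M = 0 × u^⊥` and
`T_p M = ℝ × u^⊥`. -/
def IsPSubmanifold (N : Set (ℝ × E)) : Prop :=
  (∀ p ∈ N, 0 ≤ p.1 ∧ ‖p.2‖ = 1) ∧
  (∀ p ∈ N, 0 < p.1 → IsSmoothPoint N p) ∧
  (∀ p ∈ N, p.1 = 0 →
    ∃ (Φ : OpenPartialHomeomorph (ℝ × E) (ℝ × E)) (V : Submodule ℝ (ℝ × E))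
      (ℓ : (ℝ × E) →L[ℝ] ℝ),
      IsBoundaryChart N p Φ V ℓ ∧
      V.comap (fderiv ℝ Φ p).toLinearMap ⊔ Submodule.prod ⊥ (ℝ ∙ p.2)ᗮ
        = Submodule.prod ⊤ (ℝ ∙ p.2)ᗮ)

/-- The strict transform of `S` by the spherical blowing-up `(t, u) ↦ t u + a` of `E` at `a`:
the closure of the preimage of `S \ {a}`. -/
def strictTransform (S : Set E) (a : E) : Set (ℝ × E) :=
  closure {p : ℝ × E | 0 < p.1 ∧ ‖p.2‖ = 1 ∧ a + p.1 • p.2 ∈ S}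

/-- `a` is a conic point of `X`: the germ of `X` at `a` is non-empty and closed, and for some
`r > 0` the strict transform of `X ∩ B(a, r)`, taken in `[0, r) × 𝕊`, is a p-sub-manifold of
`[0, r) × 𝕊` (being a closure, it is automatically closed there). -/
def IsConicPoint (X : Set E) (a : E) : Prop :=
  a ∈ X ∧ (∃ ε > 0, IsClosed (X ∩ Metric.closedBall a ε)) ∧
    ∃ r > 0, IsPSubmanifold (strictTransform (X ∩ Metric.ball a r) a ∩ {p | p.1 < r})

/-- The closure of `X`, near the sphere at infinity `{0} × 𝕊`, in the compactification of `E`,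
seen in the chart `(t, u) ↦ t⁻¹ u` on `[0, ∞) × 𝕊`. -/
def closureAtInfinity (X : Set E) : Set (ℝ × E) :=
  closure {p : ℝ × E | 0 < p.1 ∧ ‖p.2‖ = 1 ∧ p.1⁻¹ • p.2 ∈ X}

/-- The asymptotic set of `X` at infinity, a subset of the unit sphere. -/
def asymptoticSet (X : Set E) : Set E := {u | ((0 : ℝ), u) ∈ closureAtInfinity X}

/-- `X` is conic at infinity: it is bounded, or its asymptotic set is non-empty and the germ of
the closure of `X` along the asymptotic set is that of a p-sub-manifold. -/
def IsConicAtInfinity (X : Set E) : Prop :=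
  Bornology.IsBounded X ∨
    ((asymptoticSet X).Nonempty ∧
      ∃ W : Set (ℝ × E), IsOpen W ∧ {(0 : ℝ)} ×ˢ asymptoticSet X ⊆ W ∧
        IsPSubmanifold (closureAtInfinity X ∩ W))

/-- Conic singular sub-manifolds of a Euclidean space. -/
structure IsConicSingularSubmanifold (X : Set E) : Prop where
  isClosed : IsClosed X
  finite_singularLocus : (singularLocus X).Finite
  conic_of_singular : ∀ a ∈ singularLocus X, IsConicPoint X a
  conic_at_infinity : IsConicAtInfinity X

end Conic

end ConicLNE

/-!
Near a smooth point, `X` is a bi-Lipschitz image of a ball of a linear subspace. Near a conic point,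
and near infinity, use polar coordinates `(t, u)`: transversality to `{t = 0}` provides collar
charts, in which two points in nearby directions are joined by moving the one of larger radius along
a section of `t` down to the smaller radius, and then moving inside a slice `{t = const}`. Both
curves have length comparable to the distance in `E`. Two points in distinct directions are at a
distance comparable to the sum of their radii, so that one can afford to join them through the
centre. At infinity the radius is `1 / t`, and any point of `X` may serve as the centre, because
connectedness makes the inner distance finite. This finiteness and compactness then globalise the
local estimates.
-/

namespace ConicLNE

open Filter Topology Set
open scoped NNReal

section InnerDist

variable {E : Type*} [PseudoEMetricSpace E] {S : Set E} {x y z : E}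

lemma eVariationOn_path_symm (γ : Path x y) : eVariationOn γ.symm univ ≤ eVariationOn γ univ :=
  eVariationOn.comp_le_of_antitoneOn γ unitInterval.symm
    (fun _ _ _ _ h => unitInterval.symm_le_symm.2 h) (mapsTo_univ _ _)

lemma innerDist_comm (S : Set E) (x y : E) : innerDist S x y = innerDist S y x := by
  have aux (x y : E) : innerDist S y x ≤ innerDist S x y := le_iInf₂ fun γ hγ =>
    (iInf₂_le γ.symm (by rwa [Path.symm_range])).trans (eVariationOn_path_symm γ)
  exact le_antisymm (aux y x) (aux x y)

lemma eVariationOn_extend_comp_le {f : unitInterval → ℝ} {s : Set unitInterval} (γ : Path x y)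
    (hf : MonotoneOn f s) : eVariationOn (γ.extend ∘ f) s ≤ eVariationOn γ univ :=
  eVariationOn.comp_le_of_monotoneOn γ (projIcc 0 1 zero_le_one ∘ f)
    ((monotone_projIcc _).comp_monotoneOn hf) (mapsTo_univ _ _)

lemma eVariationOn_path_trans (γ : Path x y) (γ' : Path y z) :
    eVariationOn (γ.trans γ') univ ≤ eVariationOn γ univ + eVariationOn γ' univ := by
  let half : unitInterval := ⟨1 / 2, by norm_num, by norm_num⟩
  have left : EqOn (γ.trans γ') (γ.extend ∘ fun t => 2 * (t : ℝ)) (Iic half) := fun t ht => by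
    rw [← Path.extend_extends', Path.extend_trans_of_le_half _ _ ht, Function.comp_apply]
  have right : EqOn (γ.trans γ') (γ'.extend ∘ fun t => 2 * (t : ℝ) - 1) (Ici half) :=
    fun t ht => by
      rw [← Path.extend_extends', Path.extend_trans_of_half_le _ _ ht, Function.comp_apply]
  calc eVariationOn (γ.trans γ') univ
      = eVariationOn (γ.trans γ') (Iic half) + eVariationOn (γ.trans γ') (Ici half) := by
        rw [← eVariationOn.union _ isGreatest_Iic isLeast_Ici, Iic_union_Ici]
    _ ≤ eVariationOn γ univ + eVariationOn γ' univ := by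
      rw [eVariationOn.congr left, eVariationOn.congr right]
      refine add_le_add (eVariationOn_extend_comp_le γ ?_) (eVariationOn_extend_comp_le γ' ?_) <;>
        · intro s _ t _ (h : (s : ℝ) ≤ t)
          linarith

lemma innerDist_triangle (S : Set E) (x y z : E) :
    innerDist S x z ≤ innerDist S x y + innerDist S y z :=
  ENNReal.le_iInf₂_add_iInf₂ fun γ hγ γ' hγ' =>
    (iInf₂_le (γ.trans γ') (by rw [Path.trans_range]; exact union_subset hγ hγ')).trans
      (eVariationOn_path_trans γ γ')

lemma innerDist_le_ofReal_add {A B : ℝ} (hA : 0 ≤ A) (hB : 0 ≤ B)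
    (hxy : innerDist S x y ≤ ENNReal.ofReal A) (hyz : innerDist S y z ≤ ENNReal.ofReal B) :
    innerDist S x z ≤ ENNReal.ofReal (A + B) := by
  rw [ENNReal.ofReal_add hA hB]
  exact (innerDist_triangle S x y z).trans (add_le_add hxy hyz)

lemma innerDist_le_eVariationOn {c : ℝ → E} {a b : ℝ} (hab : a ≤ b)
    (hc : ContinuousOn c (Icc a b)) (hS : MapsTo c (Icc a b) S) :
    innerDist S (c a) (c b) ≤ eVariationOn c (Icc a b) := by
  let θ (t : unitInterval) : ℝ := a + t * (b - a)
  have hθ (t : unitInterval) : θ t ∈ Icc a b :=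
    ⟨by dsimp only [θ]; nlinarith [t.2.1], by dsimp only [θ]; nlinarith [t.2.2]⟩
  let γ : Path (c a) (c b) :=
    { toFun := c ∘ θ
      continuous_toFun := hc.comp_continuous (by fun_prop) hθ
      source' := by simp [θ]
      target' := by simp [θ] }
  refine (iInf₂_le γ (range_subset_iff.2 fun t => hS (hθ t))).trans ?_
  refine eVariationOn.comp_le_of_monotoneOn c θ (fun s _ t _ (h : (s : ℝ) ≤ t) => ?_)
    fun t _ => hθ t
  dsimp only [θ]
  nlinarith

lemma innerDist_self (hx : x ∈ S) : innerDist S x x = 0 := by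
  refine le_antisymm ((innerDist_le_eVariationOn (c := fun _ => x) (le_refl (0 : ℝ))
    continuousOn_const fun _ _ => hx).trans (eVariationOn.subsingleton _ (by simp)).le) zero_le

lemma innerDist_le_of_lipschitzOnWith {c : ℝ → E} {a b : ℝ} {K : ℝ≥0} (hab : a ≤ b)
    (hc : LipschitzOnWith K c (Icc a b)) (hS : MapsTo c (Icc a b) S) :
    innerDist S (c a) (c b) ≤ ENNReal.ofReal (K * (b - a)) := by
  have hid : eVariationOn id (Icc a b) = ENNReal.ofReal (b - a) := by simp
  calc innerDist S (c a) (c b) ≤ eVariationOn c (Icc a b) :=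
        innerDist_le_eVariationOn hab hc.continuousOn hS
    _ ≤ K * eVariationOn id (Icc a b) := hc.comp_eVariationOn_le (mapsTo_id _)
    _ = ENNReal.ofReal (K * (b - a)) := by
      rw [hid, ENNReal.ofReal_mul K.coe_nonneg, ENNReal.ofReal_coe_nnreal]

end InnerDist

section LNE

variable {E : Type*} [PseudoMetricSpace E] {S A B : Set E} {a : E} {C C' : ℝ≥0}

/-- The points of `A` satisfy the Lipschitz normal embedding inequality with constant `C`, the
joining paths being allowed to run in the larger set `S`. -/
def IsLNEOn (S A : Set E) (C : ℝ≥0) : Prop :=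
  ∀ x ∈ A, ∀ y ∈ A, innerDist S x y ≤ ENNReal.ofReal (C * dist x y)

/-- The germ of `S` at `a` is Lipschitz normally embedded; the joining paths need not stay
near `a`. -/
def IsLNEAt (S : Set E) (a : E) : Prop :=
  ∃ C, ∃ U ∈ 𝓝 a, IsLNEOn S (S ∩ U) C

lemma IsLNEOn.mono (h : IsLNEOn S A C) (hBA : B ⊆ A) (hC : C ≤ C') : IsLNEOn S B C' :=
  fun x hx y hy => (h x (hBA hx) y (hBA hy)).trans (ENNReal.ofReal_le_ofReal (by gcongr))

lemma isLNEOn_singleton (ha : a ∈ S) (C : ℝ≥0) : IsLNEOn S {a} C := by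
  rintro x rfl y rfl
  simp [innerDist_self ha]

lemma IsLNEOn.isLNE (h : IsLNEOn S S C) : IsLNE S := by
  refine ⟨C + 1, by positivity, fun x hx y hy => (h x hx y hy).trans ?_⟩
  rw [ENNReal.ofReal_mul C.coe_nonneg, ← edist_dist, ENNReal.ofReal_coe_nnreal]
  gcongr
  exact le_self_add

end LNE

section LipschitzInverse

variable {F G : Type*} [NormedAddCommGroup F] [NormedSpace ℝ F] [NormedAddCommGroup G]
  [NormedSpace ℝ G]

lemma lipschitzOnWith_comp_lineMap {E : Type*} [PseudoMetricSpace E] {g : F → E} {s : Set F}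
    {K : ℝ≥0} (hg : LipschitzOnWith K g s) {y z : F} {I : Set ℝ}
    (hI : MapsTo (AffineMap.lineMap y z) I s) :
    LipschitzOnWith (K * nndist y z) (g ∘ AffineMap.lineMap y z) I :=
  hg.comp (lipschitzWith_lineMap y z).lipschitzOnWith hI

lemma exists_lipschitzOnWith_inverse [CompleteSpace F] {f : F → G} {A : F ≃L[ℝ] G} {p : F}
    (hf : HasStrictFDerivAt f (A : F →L[ℝ] G) p) {O : Set F} (hO : O ∈ 𝓝 p) :
    ∃ (g : G → F) (K : ℝ≥0), ∃ U ∈ 𝓝 p, ∃ δ > 0,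
      MapsTo f U (Metric.ball (f p) δ) ∧ LipschitzOnWith K f U ∧
      LipschitzOnWith K g (Metric.ball (f p) δ) ∧ LeftInvOn g f U ∧
      ∀ y ∈ Metric.ball (f p) δ, f (g y) = y ∧ g y ∈ O := by
  let g := hf.localInverse f A p
  obtain ⟨K, U, hU, hfK⟩ := hf.exists_lipschitzOnWith
  obtain ⟨K', W, hW, hgK⟩ := hf.to_localInverse.exists_lipschitzOnWith
  obtain ⟨δ, hδ, hball⟩ := Metric.mem_nhds_iff.1 (inter_mem hW
    (hf.eventually_right_inverse.and (hf.localInverse_tendsto.eventually hO)))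
  have hmaps : f ⁻¹' Metric.ball (f p) δ ∈ 𝓝 p :=
    hf.continuousAt.preimage_mem_nhds (Metric.ball_mem_nhds _ hδ)
  refine ⟨g, max K K', U ∩ (f ⁻¹' Metric.ball (f p) δ ∩ {x | g (f x) = x}),
    inter_mem hU (inter_mem hmaps hf.eventually_left_inverse), δ, hδ, fun x hx => hx.2.1,
    (hfK.mono inter_subset_left).weaken (le_max_left _ _),
    (hgK.mono fun y hy => (hball hy).1).weaken (le_max_right _ _), fun x hx => hx.2.2,
    fun y hy => (hball hy).2⟩

end LipschitzInverse

section TangentCones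

variable {F G : Type*} [NormedAddCommGroup F] [NormedSpace ℝ F] [NormedAddCommGroup G]
  [NormedSpace ℝ G]

lemma mapsTo_posTangentConeAt {f : F → G} {f' : F →L[ℝ] G} {s : Set F} {t : Set G} {x : F}
    (hf : HasFDerivAt f f' x) (hst : ∀ᶠ y in 𝓝 x, y ∈ s → f y ∈ t) :
    MapsTo f' (posTangentConeAt s x) (posTangentConeAt t (f x)) := by
  intro v hv
  obtain ⟨ι, l, hl, c, d, hd₀, hds, hcd⟩ := exists_fun_of_mem_tangentConeAt hv
  have hlim : Tendsto (fun n => x + d n) l (𝓝 x) := by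
    simpa using tendsto_const_nhds.add hd₀
  refine mem_tangentConeAt_of_seq l c (fun n => f (x + d n) - f x) ?_ ?_ ?_
  · rw [tendsto_sub_nhds_zero_iff]
    exact hf.continuousAt.tendsto.comp hlim
  · filter_upwards [hds, hlim.eventually hst] with n hn hn'
    simpa using hn' hn
  · exact hf.hasFDerivWithinAt.lim (s := univ) (c := fun n => (c n : ℝ)) hd₀ (by simp) hcd

lemma posTangentConeAt_eq_self {H : Set F} {y : F} (hclosed : IsClosed H)
    (hsmul : ∀ c : ℝ, 0 ≤ c → ∀ v ∈ H, c • v ∈ H) (hy : ∀ v, y + v ∈ H ↔ v ∈ H) :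
    posTangentConeAt H y = H := by
  ext v
  constructor
  · intro hv
    obtain ⟨ι, l, hl, c, d, -, hds, hcd⟩ := exists_fun_of_mem_tangentConeAt hv
    exact hclosed.mem_of_tendsto hcd (hds.mono fun n hn => hsmul _ (c n).2 _ ((hy _).1 hn))
  · intro hv
    refine mem_posTangentConeAt_of_frequently_mem (Eventually.frequently ?_)
    filter_upwards [self_mem_nhdsWithin] with t (ht : 0 < t)
    exact (hy _).2 (hsmul t ht.le v hv)

lemma posTangentConeAt_submodule [FiniteDimensional ℝ F] (V : Submodule ℝ F) {y : F}
    (hy : y ∈ V) : posTangentConeAt (V : Set F) y = V :=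
  posTangentConeAt_eq_self V.closed_of_finiteDimensional (fun c _ _ hv => V.smul_mem c hv)
    fun _ => V.add_mem_iff_right hy

lemma posTangentConeAt_halfSpace [FiniteDimensional ℝ F] (V : Submodule ℝ F) (ℓ : F →L[ℝ] ℝ)
    {y : F} (hy : y ∈ V) (hℓy : ℓ y = 0) :
    posTangentConeAt {v | v ∈ V ∧ 0 ≤ ℓ v} y = {v | v ∈ V ∧ 0 ≤ ℓ v} := by
  refine posTangentConeAt_eq_self ?_ ?_ fun v => ?_
  · exact V.closed_of_finiteDimensional.inter (isClosed_le continuous_const ℓ.continuous)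
  · rintro c hc v ⟨hv, hℓ⟩
    exact ⟨V.smul_mem c hv, by simpa using mul_nonneg hc hℓ⟩
  · simp [V.add_mem_iff_right hy, hℓy]

end TangentCones

section Charts

variable {F : Type*} [NormedAddCommGroup F] [NormedSpace ℝ F] {N : Set F} {p : F}
  {Φ : OpenPartialHomeomorph F F}

lemma IsSmoothDiffeo.exists_hasStrictFDerivAt (h : IsSmoothDiffeo Φ) (hp : p ∈ Φ.source) :
    ∃ A : F ≃L[ℝ] F, HasStrictFDerivAt Φ (A : F →L[ℝ] F) p ∧
      HasStrictFDerivAt Φ.symm (A.symm : F →L[ℝ] F) (Φ p) := by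
  have hΦ : HasStrictFDerivAt Φ (fderiv ℝ Φ p) p :=
    (h.1.contDiffAt (Φ.open_source.mem_nhds hp)).hasStrictFDerivAt (by simp)
  have hΦs : HasStrictFDerivAt Φ.symm (fderiv ℝ Φ.symm (Φ p)) (Φ p) :=
    (h.2.contDiffAt (Φ.open_target.mem_nhds (Φ.map_source hp))).hasStrictFDerivAt (by simp)
  have left : (fderiv ℝ Φ.symm (Φ p)).comp (fderiv ℝ Φ p) = ContinuousLinearMap.id ℝ F :=
    ((hΦs.comp p hΦ).hasFDerivAt.congr_of_eventuallyEq
      ((Φ.eventually_left_inverse hp).mono fun _ => Eq.symm)).unique (hasFDerivAt_id p)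
  have right : (fderiv ℝ Φ p).comp (fderiv ℝ Φ.symm (Φ p)) = ContinuousLinearMap.id ℝ F :=
    ((HasStrictFDerivAt.comp (Φ p) (by rwa [Φ.left_inv hp]) hΦs).hasFDerivAt.congr_of_eventuallyEq
      ((Φ.eventually_right_inverse (Φ.map_source hp)).mono fun _ => Eq.symm)).unique
      (hasFDerivAt_id _)
  exact ⟨ContinuousLinearEquiv.equivOfInverse _ _ (DFunLike.congr_fun left)
    (DFunLike.congr_fun right), hΦ, hΦs⟩

lemma IsSmoothDiffeo.exists_equiv_posTangentConeAt (h : IsSmoothDiffeo Φ) (hp : p ∈ Φ.source)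
    {H : Set F} (hN : ∀ x ∈ Φ.source, (x ∈ N ↔ Φ x ∈ H)) :
    ∃ A : F ≃L[ℝ] F, HasStrictFDerivAt Φ (A : F →L[ℝ] F) p ∧
      HasStrictFDerivAt Φ.symm (A.symm : F →L[ℝ] F) (Φ p) ∧
      ∀ v, v ∈ posTangentConeAt N p ↔ A v ∈ posTangentConeAt H (Φ p) := by
  obtain ⟨A, hA, hAs⟩ := h.exists_hasStrictFDerivAt hp
  refine ⟨A, hA, hAs, fun v => ⟨fun hv => ?_, fun hv => ?_⟩⟩
  · refine mapsTo_posTangentConeAt hA.hasFDerivAt ?_ hv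
    filter_upwards [Φ.open_source.mem_nhds hp] with x hx using (hN x hx).1
  · have := mapsTo_posTangentConeAt (t := N) hAs.hasFDerivAt ?_ hv
    · simpa [Φ.left_inv hp] using this
    · filter_upwards [Φ.open_target.mem_nhds (Φ.map_source hp)] with y hy hyH
      rwa [hN _ (Φ.map_target hy), Φ.right_inv hy]

variable {V : Submodule ℝ F} {ℓ : F →L[ℝ] ℝ}

lemma IsBoundaryChart.exists_mem_eq_one (h : IsBoundaryChart N p Φ V ℓ) :
    ∃ v ∈ V, ℓ v = 1 := by
  obtain ⟨v, hv, hne⟩ := h.nondegenerate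
  exact ⟨(ℓ v)⁻¹ • v, V.smul_mem _ hv, by simp [hne]⟩

variable [FiniteDimensional ℝ F]

lemma IsBoundaryChart.exists_equiv_posTangentConeAt (h : IsBoundaryChart N p Φ V ℓ) (hp : p ∈ N) :
    ∃ A : F ≃L[ℝ] F, HasStrictFDerivAt Φ (A : F →L[ℝ] F) p ∧
      HasStrictFDerivAt Φ.symm (A.symm : F →L[ℝ] F) (Φ p) ∧
      ∀ v, v ∈ posTangentConeAt N p ↔ A v ∈ V ∧ 0 ≤ ℓ (A v) := by
  obtain ⟨A, hA, hAs, hcone⟩ := h.smooth.exists_equiv_posTangentConeAt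
    (H := {v | v ∈ V ∧ 0 ≤ ℓ v}) h.mem_source h.mem_iff
  rw [posTangentConeAt_halfSpace V ℓ ((h.mem_iff p h.mem_source).1 hp).1 h.boundary] at hcone
  exact ⟨A, hA, hAs, hcone⟩

/-- The tangent cone of a smooth point is invariant under `v ↦ -v`, while that of a boundary point
is a proper half-space. -/
lemma IsBoundaryChart.not_isSmoothPoint (h : IsBoundaryChart N p Φ V ℓ) (hp : p ∈ N) :
    ¬ IsSmoothPoint N p := by
  rintro ⟨Φ', V', hΦ', hpΦ', hN'⟩
  obtain ⟨A, -, -, hA⟩ := h.exists_equiv_posTangentConeAt hp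
  obtain ⟨B, -, -, hB⟩ := hΦ'.exists_equiv_posTangentConeAt (H := V') hpΦ' hN'
  rw [posTangentConeAt_submodule V' ((hN' p hpΦ').1 hp)] at hB
  obtain ⟨v, hv, hℓ⟩ := h.exists_mem_eq_one
  have hv_mem : A.symm v ∈ posTangentConeAt N p := (hA _).2 (by simp [hv, hℓ])
  have hneg : -A.symm v ∈ posTangentConeAt N p := by
    rw [hB, map_neg]
    exact V'.neg_mem ((hB _).1 hv_mem)
  have := ((hA _).1 hneg).2
  simp only [map_neg, ContinuousLinearEquiv.apply_symm_apply, hℓ] at this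
  linarith

lemma IsSmoothPoint.isLNEAt (hp : IsSmoothPoint N p) : IsLNEAt N p := by
  obtain ⟨Φ, V, hΦ, hpΦ, hN⟩ := hp
  obtain ⟨A, hA, -⟩ := hΦ.exists_hasStrictFDerivAt hpΦ
  obtain ⟨g, K, U, hU, δ, -, hUδ, hΦK, hgK, hg, hΦg⟩ :=
    exists_lipschitzOnWith_inverse hA (Φ.open_source.mem_nhds hpΦ)
  refine ⟨K * K, U ∩ Φ.source, inter_mem hU (Φ.open_source.mem_nhds hpΦ), ?_⟩
  rintro x ⟨hxN, hxU, hxΦ⟩ y ⟨hyN, hyU, hyΦ⟩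
  have hball : MapsTo (AffineMap.lineMap (Φ x) (Φ y)) (Icc (0 : ℝ) 1) (Metric.ball (Φ p) δ) :=
    fun θ hθ => (convex_ball (Φ p) δ).lineMap_mem (hUδ hxU) (hUδ hyU) hθ
  have hcurve := innerDist_le_of_lipschitzOnWith (S := N) zero_le_one
    (lipschitzOnWith_comp_lineMap hgK hball) fun θ hθ => by
      obtain ⟨hΦθ, hθsource⟩ := hΦg _ (hball hθ)
      rw [Function.comp_apply, hN _ hθsource, hΦθ]
      exact V.convex.lineMap_mem ((hN x hxΦ).1 hxN) ((hN y hyΦ).1 hyN) hθ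
  rw [Function.comp_apply, Function.comp_apply, AffineMap.lineMap_apply_zero,
    AffineMap.lineMap_apply_one, hg hxU, hg hyU] at hcurve
  refine hcurve.trans (ENNReal.ofReal_le_ofReal ?_)
  calc ((K * nndist (Φ x) (Φ y) : ℝ≥0) : ℝ) * (1 - 0) = K * dist (Φ x) (Φ y) := by simp
    _ ≤ K * (K * dist x y) := by gcongr; exact hΦK.dist_le_mul x hxU y hyU
    _ = (K * K : ℝ≥0) * dist x y := by push_cast; ring

end Charts

section HalfSpaces

variable {F : Type*} [NormedAddCommGroup F] [NormedSpace ℝ F]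

lemma eq_mul_of_nonneg_on_halfSpace {V : Submodule ℝ F} {ℓ τ : F →ₗ[ℝ] ℝ}
    (h : ∀ v ∈ V, 0 ≤ ℓ v → 0 ≤ τ v) {v₀ : F} (hv₀ : v₀ ∈ V) (hℓ : ℓ v₀ = 1) {v : F}
    (hv : v ∈ V) : τ v = τ v₀ * ℓ v := by
  have hker : ∀ w ∈ V, ℓ w = 0 → τ w = 0 := fun w hw hw0 =>
    le_antisymm (by simpa using h (-w) (V.neg_mem hw) (by simp [hw0])) (h w hw hw0.ge)
  have := hker (v - ℓ v • v₀) (V.sub_mem hv (V.smul_mem _ hv₀)) (by simp [hℓ])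
  rw [map_sub, map_smul, smul_eq_mul] at this
  linarith

lemma eventually_lt_add_smul {g : F → ℝ} {g' : F →L[ℝ] ℝ} {y v : F}
    (hg : HasStrictFDerivAt g g' y) (hv : 0 < g' v) :
    ∀ᶠ q : F × ℝ in 𝓝 (y, 0), 0 < q.2 → g q.1 < g (q.1 + q.2 • v) := by
  obtain ⟨η, hη, hηv⟩ := exists_pos_mul_lt hv ‖v‖
  have hlim : Tendsto (fun q : F × ℝ => (q.1 + q.2 • v, q.1)) (𝓝 (y, 0)) (𝓝 (y, y)) := by
    have : Continuous fun q : F × ℝ => (q.1 + q.2 • v, q.1) := by fun_prop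
    simpa using this.tendsto (y, 0)
  filter_upwards [hlim.eventually ((hasStrictFDerivAt_iff_isLittleO.1 hg).def hη)] with q hq hq0
  rw [add_sub_cancel_left, map_smul, smul_eq_mul, norm_smul, Real.norm_eq_abs, Real.norm_eq_abs,
    abs_of_pos hq0] at hq
  have hlow := (abs_le.1 hq).1
  nlinarith

end HalfSpaces

section Collar

variable {E : Type*} [NormedAddCommGroup E]

/-- `Ψ` straightens `N` near `p` to the half-space `{v ∈ V | 0 ≤ ℓ v}` in such a way that `ℓ`
becomes the boundary defining function `t` of `[0, ∞) × 𝕊`. Only strict differentiability of `Ψ`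
at `p` is recorded, which suffices for a bi-Lipschitz inverse. -/
structure IsCollarChart [NormedSpace ℝ E] (N : Set (ℝ × E)) (p : ℝ × E) (Ψ : ℝ × E → ℝ × E)
    (V : Submodule ℝ (ℝ × E)) (ℓ : (ℝ × E) →L[ℝ] ℝ) : Prop where
  exists_hasStrictFDerivAt : ∃ A : (ℝ × E) ≃L[ℝ] (ℝ × E),
    HasStrictFDerivAt Ψ (A : (ℝ × E) →L[ℝ] (ℝ × E)) p
  exists_mem_eq_one : ∃ v ∈ V, ℓ v = 1
  apply_eq_fst : ∀ x, ℓ (Ψ x) = x.1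
  eventually_mem_iff : ∀ᶠ x in 𝓝 p, (x ∈ N ↔ Ψ x ∈ V ∧ 0 ≤ x.1)

variable [InnerProductSpace ℝ E] [FiniteDimensional ℝ E] {N : Set (ℝ × E)} {p : ℝ × E}
  {Φ : OpenPartialHomeomorph (ℝ × E) (ℝ × E)} {V : Submodule ℝ (ℝ × E)} {ℓ : (ℝ × E) →L[ℝ] ℝ}

lemma IsPSubmanifold.fst_eq_zero (hN : IsPSubmanifold N) (hΦ : IsBoundaryChart N p Φ V ℓ)
    {x : ℝ × E} (hx : x ∈ Φ.source) (hxV : Φ x ∈ V) (hx0 : ℓ (Φ x) = 0) : x.1 = 0 := by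
  have hxN : x ∈ N := (hΦ.mem_iff x hx).2 ⟨hxV, hx0.ge⟩
  have hchart : IsBoundaryChart N x Φ V ℓ := ⟨hΦ.smooth, hx, hΦ.nondegenerate, hx0, hΦ.mem_iff⟩
  by_contra hne
  exact hchart.not_isSmoothPoint hxN (hN.2.1 x hxN ((hN.1 x hxN).1.lt_of_ne' hne))

lemma IsPSubmanifold.exists_fst_eq_mul (hN : IsPSubmanifold N) (hp : p ∈ N) (hp0 : p.1 = 0)
    (hΦ : IsBoundaryChart N p Φ V ℓ)
    (htrans : V.comap (fderiv ℝ Φ p).toLinearMap ⊔ Submodule.prod ⊥ (ℝ ∙ p.2)ᗮ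
      = Submodule.prod ⊤ (ℝ ∙ p.2)ᗮ) :
    ∃ A : (ℝ × E) ≃L[ℝ] (ℝ × E), HasStrictFDerivAt Φ (A : (ℝ × E) →L[ℝ] (ℝ × E)) p ∧
      HasStrictFDerivAt Φ.symm (A.symm : (ℝ × E) →L[ℝ] (ℝ × E)) (Φ p) ∧
      ∃ τ > 0, ∀ h, A h ∈ V → h.1 = τ * ℓ (A h) := by
  obtain ⟨A, hA, hAs, hcone⟩ := hΦ.exists_equiv_posTangentConeAt hp
  rw [hA.hasFDerivAt.fderiv] at htrans
  obtain ⟨v₀, hv₀, hℓ⟩ := hΦ.exists_mem_eq_one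
  have hmin : IsLocalMinOn Prod.fst N p :=
    eventually_mem_nhdsWithin.mono fun x hx => hp0.trans_le (hN.1 x hx).1
  have hnonneg : ∀ v ∈ V, 0 ≤ ℓ v → 0 ≤ (A.symm v).1 := fun v hv hℓv =>
    hmin.hasFDerivWithinAt_nonneg hasFDerivAt_fst.hasFDerivWithinAt
      ((hcone _).2 (by simpa using ⟨hv, hℓv⟩))
  have hmul : ∀ h, A h ∈ V → h.1 = (A.symm v₀).1 * ℓ (A h) := fun h hh => by
    simpa using eq_mul_of_nonneg_on_halfSpace (ℓ := ℓ.toLinearMap)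
      (τ := LinearMap.fst ℝ ℝ E ∘ₗ (A.symm : (ℝ × E) →ₗ[ℝ] (ℝ × E))) hnonneg hv₀ hℓ hh
  refine ⟨A, hA, hAs, _, (hnonneg v₀ hv₀ (hℓ ▸ zero_le_one)).lt_of_ne' fun h0 => ?_, hmul⟩
  have hmem : ((1 : ℝ), (0 : E)) ∈ Submodule.prod (⊤ : Submodule ℝ ℝ) (ℝ ∙ p.2)ᗮ := by simp
  rw [← htrans] at hmem
  obtain ⟨h, hh, k, hk, hhk⟩ := Submodule.mem_sup.1 hmem
  have hk0 : k.1 = 0 := by simpa using hk.1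
  have hh1 : h.1 = 1 := by simpa [hk0] using congrArg Prod.fst hhk
  have hh0 : h.1 = 0 := by rw [hmul h hh, h0, zero_mul]
  exact one_ne_zero (hh1.symm.trans hh0)

lemma IsPSubmanifold.eventually_nonneg_of_fst_nonneg (hN : IsPSubmanifold N)
    (hΦ : IsBoundaryChart N p Φ V ℓ) {A : (ℝ × E) ≃L[ℝ] (ℝ × E)}
    (hA : HasStrictFDerivAt Φ.symm (A.symm : (ℝ × E) →L[ℝ] (ℝ × E)) (Φ p)) {v₀ : ℝ × E}
    (hv₀ : v₀ ∈ V) (hℓ : ℓ v₀ = 1) (hτ : 0 < (A.symm v₀).1) :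
    ∀ᶠ x in 𝓝 p, Φ x ∈ V → 0 ≤ x.1 → 0 ≤ ℓ (Φ x) := by
  have hfst : HasStrictFDerivAt (fun y => (Φ.symm y).1)
      ((ContinuousLinearMap.fst ℝ ℝ E).comp (A.symm : (ℝ × E) →L[ℝ] (ℝ × E))) (Φ p) :=
    hasStrictFDerivAt_fst.comp (Φ p) hA
  have hincr : ∀ᶠ q : (ℝ × E) × ℝ in 𝓝 (Φ p, 0),
      0 < q.2 → (Φ.symm q.1).1 < (Φ.symm (q.1 + q.2 • v₀)).1 :=
    eventually_lt_add_smul hfst hτ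
  have hcont : ContinuousAt Φ p := Φ.continuousAt hΦ.mem_source
  have hlim : Tendsto (fun x => (Φ x, -ℓ (Φ x))) (𝓝 p) (𝓝 (Φ p, 0)) := by
    simpa [hΦ.boundary] using
      hcont.tendsto.prodMk_nhds ((ℓ.continuous.continuousAt.comp hcont).tendsto.neg)
  have htarget : ∀ᶠ x in 𝓝 p, Φ x + -ℓ (Φ x) • v₀ ∈ Φ.target := by
    have hadd : Tendsto (fun q : (ℝ × E) × ℝ => q.1 + q.2 • v₀) (𝓝 (Φ p, 0)) (𝓝 (Φ p)) := by
      have : Continuous fun q : (ℝ × E) × ℝ => q.1 + q.2 • v₀ := by fun_prop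
      simpa using this.tendsto (Φ p, 0)
    exact (hadd.comp hlim).eventually (Φ.open_target.mem_nhds (Φ.map_source hΦ.mem_source))
  filter_upwards [Φ.open_source.mem_nhds hΦ.mem_source, hlim.eventually hincr, htarget]
    with x hx hlt hxt hxV hx0
  by_contra! hneg
  have hboundary : (Φ.symm (Φ x + -ℓ (Φ x) • v₀)).1 = 0 := by
    refine hN.fst_eq_zero hΦ (Φ.map_target hxt) ?_ ?_ <;> rw [Φ.right_inv hxt]
    · exact V.add_mem hxV (V.smul_mem _ hv₀)
    · simp [hℓ]
  have := hlt (neg_pos.2 hneg)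
  rw [hboundary, Φ.left_inv hx] at this
  linarith

lemma IsPSubmanifold.exists_isCollarChart (hN : IsPSubmanifold N) (hp : p ∈ N) (hp0 : p.1 = 0) :
    ∃ Ψ V ℓ, IsCollarChart N p Ψ V ℓ := by
  obtain ⟨Φ, V, ℓ, hΦ, htrans⟩ := hN.2.2 p hp hp0
  obtain ⟨A, hA, hAs, τ, hτ, hmul⟩ := hN.exists_fst_eq_mul hp hp0 hΦ htrans
  obtain ⟨v₀, hv₀, hℓ⟩ := hΦ.exists_mem_eq_one
  let D : (ℝ × E) →L[ℝ] (ℝ × E) := (A : (ℝ × E) →L[ℝ] (ℝ × E)) +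
    (ContinuousLinearMap.fst ℝ ℝ E - ℓ.comp (A : (ℝ × E) →L[ℝ] (ℝ × E))).smulRight v₀
  have hD (h : ℝ × E) : D h = A h + (h.1 - ℓ (A h)) • v₀ := rfl
  have hinj : Function.Injective D := (injective_iff_map_eq_zero D).2 fun h hh => by
    have hh1 : h.1 = 0 := by simpa [hD, hℓ] using congrArg ℓ hh
    have hAh : A h ∈ V := by
      rw [eq_neg_of_add_eq_zero_left ((hD h).symm.trans hh)]
      exact V.neg_mem (V.smul_mem _ hv₀)
    have hℓA : ℓ (A h) = 0 := by
      simpa [hh1, hτ.ne'] using hmul h hAh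
    simpa [hD, hh1, hℓA] using hh
  let D' : (ℝ × E) ≃L[ℝ] (ℝ × E) :=
    (LinearEquiv.ofInjectiveEndo D.toLinearMap hinj).toContinuousLinearEquiv
  have hD' : (D' : (ℝ × E) →L[ℝ] (ℝ × E)) = D := rfl
  refine ⟨fun x => Φ x + (x.1 - ℓ (Φ x)) • v₀, V, ℓ, ⟨D', ?_⟩, ⟨v₀, hv₀, hℓ⟩, fun x => ?_, ?_⟩
  · rw [hD']
    exact hA.add ((hasStrictFDerivAt_fst.sub (ℓ.hasStrictFDerivAt.comp p hA)).smul_const v₀)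
  · simp [hℓ]
  · have hAv₀ : 0 < (A.symm v₀).1 := by
      rw [hmul _ (by simpa using hv₀)]
      simpa [hℓ] using hτ
    filter_upwards [Φ.open_source.mem_nhds hΦ.mem_source,
      hN.eventually_nonneg_of_fst_nonneg hΦ hAs hv₀ hℓ hAv₀] with x hx hside
    rw [V.add_mem_iff_left (V.smul_mem _ hv₀)]
    exact ⟨fun hxN => ⟨((hΦ.mem_iff x hx).1 hxN).1, (hN.1 x hxN).1⟩,
      fun h => (hΦ.mem_iff x hx).2 ⟨h.1, hside h.1 h.2⟩⟩

end Collar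

section CollarCurves

variable {E : Type*} [NormedAddCommGroup E] [InnerProductSpace ℝ E]
  {N : Set (ℝ × E)} {p : ℝ × E} {Ψ : ℝ × E → ℝ × E} {V : Submodule ℝ (ℝ × E)}
  {ℓ : (ℝ × E) →L[ℝ] ℝ}

lemma IsCollarChart.eventually_add_smul_mem_ball (hΨ : IsCollarChart N p Ψ V ℓ) (v : ℝ × E)
    {δ : ℝ} (hδ : 0 < δ) :
    ∃ U ∈ 𝓝 p, ∀ x ∈ U, ∀ y ∈ U, Ψ x + (y.1 - x.1) • v ∈ Metric.ball (Ψ p) δ := by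
  obtain ⟨A, hA⟩ := hΨ.exists_hasStrictFDerivAt
  have hlim : Tendsto (fun q : (ℝ × E) × (ℝ × E) => Ψ q.1 + (q.2.1 - q.1.1) • v)
      (𝓝 p ×ˢ 𝓝 p) (𝓝 (Ψ p)) := by
    rw [← nhds_prod_eq]
    have : ContinuousAt (fun q : (ℝ × E) × (ℝ × E) => Ψ q.1 + (q.2.1 - q.1.1) • v) (p, p) :=
      (hA.continuousAt.comp_of_eq continuousAt_fst rfl).add (by fun_prop)
    simpa [ContinuousAt] using this
  obtain ⟨U, hU, h⟩ := mem_prod_same_iff.1 (hlim (Metric.ball_mem_nhds _ hδ))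
  exact ⟨U, hU, fun x hx y hy => h (mk_mem_prod hx hy)⟩

variable [FiniteDimensional ℝ E]

lemma IsCollarChart.exists_parametrization (hΨ : IsCollarChart N p Ψ V ℓ) :
    ∃ (G : ℝ × E → E) (H : Set (ℝ × E)) (v : ℝ × E) (K : ℝ≥0), ∃ U ∈ 𝓝 p,
      Convex ℝ H ∧ LipschitzOnWith K G H ∧ (∀ q ∈ H, 0 ≤ ℓ q → (ℓ q, G q) ∈ N) ∧
      LipschitzOnWith K Ψ (N ∩ U) ∧ (∀ x ∈ N ∩ U, Ψ x ∈ H ∧ G (Ψ x) = x.2) ∧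
      ℓ v = 1 ∧ ∀ x ∈ N ∩ U, ∀ y ∈ N ∩ U, Ψ x + (y.1 - x.1) • v ∈ H := by
  obtain ⟨A, hA⟩ := hΨ.exists_hasStrictFDerivAt
  obtain ⟨v, hv, hℓ⟩ := hΨ.exists_mem_eq_one
  obtain ⟨g, K, U, hU, δ, hδ, hmaps, hΨK, hgK, hleft, hright⟩ :=
    exists_lipschitzOnWith_inverse hA hΨ.eventually_mem_iff
  obtain ⟨U', hU', hshift⟩ := hΨ.eventually_add_smul_mem_ball v hδ
  have hV : ∀ x ∈ N ∩ (U ∩ U' ∩ {x | x ∈ N ↔ Ψ x ∈ V ∧ 0 ≤ x.1}), Ψ x ∈ V :=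
    fun x hx => (hx.2.2.1 hx.1).1
  refine ⟨Prod.snd ∘ g, Metric.ball (Ψ p) δ ∩ V, v, K, _,
    inter_mem (inter_mem hU hU') hΨ.eventually_mem_iff, (convex_ball _ _).inter V.convex, ?_,
    fun q ⟨hq, hqV⟩ hq0 => ?_, hΨK.mono fun x hx => hx.2.1.1,
    fun x hx => ⟨⟨hmaps hx.2.1.1, hV x hx⟩, congrArg Prod.snd (hleft hx.2.1.1)⟩, hℓ,
    fun x hx y hy => ⟨hshift x hx.2.1.2 y hy.2.1.2, V.add_mem (hV x hx) (V.smul_mem _ hv)⟩⟩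
  · simpa only [one_mul] using
      (LipschitzWith.prod_snd.comp_lipschitzOnWith hgK).mono inter_subset_left
  · obtain ⟨hΨg, hgN⟩ := hright q hq
    have hfst : ℓ q = (g q).1 := by rw [← hΨ.apply_eq_fst, hΨg]
    rw [hfst]
    exact hgN.2 ⟨by rwa [hΨg], by rwa [← hfst]⟩

lemma IsPSubmanifold.exists_section_and_slice_curve (hN : IsPSubmanifold N) (hp : p ∈ N)
    (hp0 : p.1 = 0) :
    ∃ K : ℝ≥0, ∃ U ∈ 𝓝 p, ∀ x ∈ N ∩ U, ∀ y ∈ N ∩ U, ∃ c d : ℝ → E,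
      (LipschitzOnWith K c (uIcc x.1 y.1) ∧ c x.1 = x.2 ∧ ∀ s ∈ uIcc x.1 y.1, (s, c s) ∈ N) ∧
      LipschitzOnWith (K * nndist x y) d (Icc 0 1) ∧ d 0 = c y.1 ∧ d 1 = y.2 ∧
        ∀ θ ∈ Icc (0 : ℝ) 1, (y.1, d θ) ∈ N := by
  obtain ⟨Ψ, V, ℓ, hΨ⟩ := hN.exists_isCollarChart hp hp0
  obtain ⟨G, H, v, K, U, hU, hH, hG, hGN, hΨK, hΨH, hℓ, hshift⟩ := hΨ.exists_parametrization
  refine ⟨K * (K + ‖v‖₊), U, hU, fun x hx y hy => ?_⟩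
  let line : ℝ →ᵃ[ℝ] ℝ × E := AffineMap.lineMap (Ψ x - x.1 • v) (Ψ x - x.1 • v + v)
  have hline (s : ℝ) : line s = Ψ x + (s - x.1) • v := by
    simp only [line, AffineMap.lineMap_apply_module', add_sub_cancel_left]
    module
  have hline_x : line x.1 = Ψ x := by simp [hline]
  have hℓ_line (s : ℝ) : ℓ (line s) = s := by simp [hline, hℓ, hΨ.apply_eq_fst]
  have hline_y : line y.1 ∈ H := by simpa only [hline] using hshift x hx y hy
  have hline_H : MapsTo line (uIcc x.1 y.1) H :=
    (hH.affine_preimage line).ordConnected.uIcc_subset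
      (by simpa only [mem_preimage, hline_x] using (hΨH x hx).1) hline_y
  have hslice_H : MapsTo (AffineMap.lineMap (line y.1) (Ψ y)) (Icc (0 : ℝ) 1) H :=
    fun θ hθ => hH.lineMap_mem hline_y (hΨH y hy).1 hθ
  refine ⟨G ∘ line, G ∘ AffineMap.lineMap (line y.1) (Ψ y),
    ⟨(lipschitzOnWith_comp_lineMap hG hline_H).weaken ?_, ?_, fun s hs => ?_⟩,
    (lipschitzOnWith_comp_lineMap hG hslice_H).weaken ?_, ?_, ?_, fun θ hθ => ?_⟩
  · have hv : nndist (Ψ x - x.1 • v) (Ψ x - x.1 • v + v) = ‖v‖₊ := by simp [← NNReal.coe_inj]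
    rw [hv]
    gcongr
    exact le_add_self
  · rw [Function.comp_apply, hline_x, (hΨH x hx).2]
  · have := hGN _ (hline_H hs)
    rw [hℓ_line] at this
    exact this ((le_inf (hN.1 x hx.1).1 (hN.1 y hy.1).1).trans hs.1)
  · rw [mul_assoc]
    gcongr
    have hfst : ‖y.1 - x.1‖ ≤ dist x y := by
      rw [← dist_eq_norm, dist_comm]
      exact le_max_left _ _
    calc dist (line y.1) (Ψ y) ≤ dist (line y.1) (Ψ x) + dist (Ψ x) (Ψ y) := dist_triangle _ _ _
      _ ≤ dist x y * ‖v‖ + K * dist x y := by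
        refine add_le_add ?_ (hΨK.dist_le_mul x hx y hy)
        rw [hline, dist_self_add_left, norm_smul]
        gcongr
      _ = (K + ‖v‖) * dist x y := by ring
  · simp
  · simp [(hΨH y hy).2]
  · have hℓ_slice : ℓ (AffineMap.lineMap (line y.1) (Ψ y) θ) = y.1 := by
      simp [AffineMap.lineMap_apply, hℓ_line, hΨ.apply_eq_fst]
    simpa only [hℓ_slice, Function.comp_apply] using
      hGN _ (hslice_H hθ) (by simpa only [hℓ_slice] using (hN.1 y hy.1).1)

end CollarCurves

section Polar

/-- The radius as a function `φ` of the boundary defining function `t ∈ I`: it is `t` near a point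
and `t⁻¹` near infinity. Both being involutions, `φ` also gives `t` as a function of the radius. -/
structure IsRadius (φ : ℝ → ℝ) (I : Set ℝ) : Prop where
  involutive : Function.Involutive φ
  ordConnected : I.OrdConnected
  nonneg : ∀ t ∈ I, 0 ≤ φ t
  mapsTo_uIcc : ∀ s ∈ I, ∀ t ∈ I, MapsTo φ (uIcc (φ s) (φ t)) (uIcc s t)
  mul_abs_sub_le : ∀ s ∈ I, ∀ t ∈ I, φ s ≤ φ t → φ s * |s - t| ≤ φ t - φ s

lemma isRadius_id {r : ℝ} (hr : r ≤ 1) : IsRadius id (Icc 0 r) where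
  involutive := fun _ => rfl
  ordConnected := ordConnected_Icc
  nonneg _ h := h.1
  mapsTo_uIcc s _ t _ := mapsTo_id _
  mul_abs_sub_le s hs t _ hst := by
    simp only [id] at hst ⊢
    rw [abs_sub_comm, abs_of_nonneg (sub_nonneg.2 hst)]
    exact mul_le_of_le_one_left (sub_nonneg.2 hst) (hs.2.trans hr)

lemma isRadius_inv : IsRadius (fun t => t⁻¹) (Ioc 0 1) where
  involutive := inv_involutive
  ordConnected := ordConnected_Ioc
  nonneg _ h := inv_nonneg.2 h.1.le
  mapsTo_uIcc s hs t ht σ hσ := by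
    wlog hst : s ≤ t generalizing s t
    · rw [uIcc_comm]
      exact this t ht s hs (by rwa [uIcc_comm]) (le_of_not_ge hst)
    rw [uIcc_of_ge (inv_anti₀ hs.1 hst)] at hσ
    rw [uIcc_of_le hst]
    have hσ0 : 0 < σ := (inv_pos.2 ht.1).trans_le hσ.1
    exact ⟨(le_inv_comm₀ hσ0 hs.1).1 hσ.2, (inv_le_comm₀ ht.1 hσ0).1 hσ.1⟩
  mul_abs_sub_le s hs t ht hst := by
    have hts : t ≤ s := (inv_le_inv₀ hs.1 ht.1).1 hst
    have hinv : s⁻¹ * (s - t) = t * (t⁻¹ - s⁻¹) := by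
      have := hs.1.ne'
      have := ht.1.ne'
      field_simp
    rw [abs_of_nonneg (sub_nonneg.2 hts), hinv]
    exact mul_le_of_le_one_left (sub_nonneg.2 hst) ht.2

variable {E : Type*} [NormedAddCommGroup E] [NormedSpace ℝ E]

lemma abs_sub_le_dist_smul {ρ ρ' : ℝ} {u u' : E} (hρ : 0 ≤ ρ) (hρ' : 0 ≤ ρ') (hu : ‖u‖ = 1)
    (hu' : ‖u'‖ = 1) : |ρ - ρ'| ≤ dist (ρ • u) (ρ' • u') := by
  simpa [norm_smul, hu, hu', abs_of_nonneg hρ, abs_of_nonneg hρ', dist_eq_norm] using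
    abs_norm_sub_norm_le (ρ • u) (ρ' • u')

lemma dist_smul_le_abs_sub_add {ρ ρ' : ℝ} {u u' : E} (hρ : 0 ≤ ρ) (hu' : ‖u'‖ = 1) :
    dist (ρ • u) (ρ' • u') ≤ |ρ - ρ'| + ρ * dist u u' :=
  calc dist (ρ • u) (ρ' • u') ≤ dist (ρ • u) (ρ • u') + dist (ρ • u') (ρ' • u') :=
        dist_triangle _ _ _
    _ = |ρ - ρ'| + ρ * dist u u' := by
      rw [dist_smul₀, Real.norm_of_nonneg hρ, dist_eq_norm (ρ • u'), ← sub_smul, norm_smul, hu',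
        mul_one, Real.norm_eq_abs, add_comm]

lemma mul_dist_le_two_mul_dist_smul {ρ ρ' : ℝ} {u u' : E} (hρ : 0 ≤ ρ) (hρ' : 0 ≤ ρ')
    (hu : ‖u‖ = 1) (hu' : ‖u'‖ = 1) : ρ * dist u u' ≤ 2 * dist (ρ • u) (ρ' • u') :=
  calc ρ * dist u u' = dist (ρ • u) (ρ • u') := by rw [dist_smul₀, Real.norm_of_nonneg hρ]
    _ ≤ dist (ρ • u) (ρ' • u') + dist (ρ' • u') (ρ • u') := dist_triangle _ _ _
    _ = dist (ρ • u) (ρ' • u') + |ρ - ρ'| := by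
      rw [dist_eq_norm (ρ' • u'), ← sub_smul, norm_smul, hu', mul_one, Real.norm_eq_abs,
        abs_sub_comm]
    _ ≤ 2 * dist (ρ • u) (ρ' • u') := by linarith [abs_sub_le_dist_smul hρ hρ' hu hu']

/-- Polar coordinates `p = (t, u)` centred at `b`, the radius being `φ t`. -/
def polarMap (φ : ℝ → ℝ) (b : E) (p : ℝ × E) : E := b + φ p.1 • p.2

lemma dist_polarMap (φ : ℝ → ℝ) (b : E) (p q : ℝ × E) :
    dist (polarMap φ b p) (polarMap φ b q) = dist (φ p.1 • p.2) (φ q.1 • q.2) :=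
  dist_add_left _ _ _

lemma dist_polarMap_center {φ : ℝ → ℝ} {p : ℝ × E} (b : E) (hφ : 0 ≤ φ p.1) (hp : ‖p.2‖ = 1) :
    dist b (polarMap φ b p) = φ p.1 := by
  rw [polarMap, dist_self_add_right, norm_smul, hp, mul_one, Real.norm_of_nonneg hφ]

lemma polarMap_norm_sub {φ : ℝ → ℝ} (hφ : Function.Involutive φ) {b x : E} (hx : x ≠ b) :
    polarMap φ b (φ ‖x - b‖, ‖x - b‖⁻¹ • (x - b)) = x := by
  rw [polarMap, hφ, smul_inv_smul₀ (norm_ne_zero_iff.2 (sub_ne_zero.2 hx)), add_sub_cancel]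

variable {φ : ℝ → ℝ} {I : Set ℝ} {S : Set E} {b : E}

lemma IsRadius.innerDist_polarMap_section_le (hφ : IsRadius φ I) {s t : ℝ} (hs : s ∈ I)
    (ht : t ∈ I) (hst : φ s ≤ φ t) {c : ℝ → E} {K : ℝ≥0} (hc : LipschitzOnWith K c (uIcc s t))
    (hnorm : ∀ r ∈ uIcc s t, ‖c r‖ = 1) (hS : ∀ r ∈ uIcc s t, polarMap φ b (r, c r) ∈ S) :
    innerDist S (polarMap φ b (s, c s)) (polarMap φ b (t, c t)) ≤
      ENNReal.ofReal ((1 + K) * (φ t - φ s)) := by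
  have huIcc : MapsTo φ (Icc (φ s) (φ t)) (uIcc s t) := by
    simpa only [uIcc_of_le hst] using hφ.mapsTo_uIcc s hs t ht
  have hI : uIcc s t ⊆ I := hφ.ordConnected.uIcc_subset hs ht
  let γ (σ : ℝ) : E := polarMap φ b (φ σ, c (φ σ))
  have hγ : LipschitzOnWith (1 + K) γ (Icc (φ s) (φ t)) := by
    refine LipschitzOnWith.of_dist_le_mul fun σ hσ τ hτ => ?_
    wlog hle : σ ≤ τ generalizing σ τ
    · rw [dist_comm, dist_comm σ]
      exact this τ hτ σ hσ (le_of_not_ge hle)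
    have hσ0 : 0 ≤ σ := (hφ.nonneg s hs).trans hσ.1
    have hrad : σ * |φ σ - φ τ| ≤ τ - σ := by
      simpa only [hφ.involutive _] using hφ.mul_abs_sub_le (φ σ) (hI (huIcc hσ)) (φ τ)
        (hI (huIcc hτ)) (by simpa only [hφ.involutive _] using hle)
    have hdist : dist σ τ = τ - σ := by
      rw [dist_comm, Real.dist_eq, abs_of_nonneg (sub_nonneg.2 hle)]
    calc dist (γ σ) (γ τ) = dist (σ • c (φ σ)) (τ • c (φ τ)) := by
          simp only [γ, dist_polarMap, hφ.involutive _]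
      _ ≤ |σ - τ| + σ * dist (c (φ σ)) (c (φ τ)) :=
        dist_smul_le_abs_sub_add hσ0 (hnorm _ (huIcc hτ))
      _ ≤ |σ - τ| + σ * (K * |φ σ - φ τ|) := by
        gcongr
        exact hc.dist_le_mul _ (huIcc hσ) _ (huIcc hτ)
      _ = dist σ τ + K * (σ * |φ σ - φ τ|) := by rw [← Real.dist_eq]; ring
      _ ≤ dist σ τ + K * dist σ τ := by rw [hdist]; gcongr
      _ = (1 + K : ℝ≥0) * dist σ τ := by push_cast; ring
  simpa only [γ, hφ.involutive _, NNReal.coe_add, NNReal.coe_one] using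
    innerDist_le_of_lipschitzOnWith hst hγ fun σ hσ => hS _ (huIcc hσ)

lemma innerDist_polarMap_slice_le {t : ℝ} (ht : 0 ≤ φ t) {d : ℝ → E} {L : ℝ≥0}
    (hd : LipschitzOnWith L d (Icc 0 1)) (hS : ∀ θ ∈ Icc (0 : ℝ) 1, polarMap φ b (t, d θ) ∈ S) :
    innerDist S (polarMap φ b (t, d 0)) (polarMap φ b (t, d 1)) ≤ ENNReal.ofReal (φ t * L) := by
  have hlip : LipschitzOnWith ((φ t).toNNReal * L) (fun θ => polarMap φ b (t, d θ)) (Icc 0 1) := by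
    refine LipschitzOnWith.of_dist_le_mul fun θ hθ θ' hθ' => ?_
    rw [dist_polarMap, dist_smul₀, Real.norm_of_nonneg ht, NNReal.coe_mul, Real.coe_toNNReal _ ht,
      mul_assoc]
    exact mul_le_mul_of_nonneg_left (hd.dist_le_mul θ hθ θ' hθ') ht
  simpa only [sub_zero, mul_one, NNReal.coe_mul, Real.coe_toNNReal _ ht] using
    innerDist_le_of_lipschitzOnWith zero_le_one hlip hS

end Polar

section LocalEstimate

variable {E : Type*} [NormedAddCommGroup E] [InnerProductSpace ℝ E] [FiniteDimensional ℝ E]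
  {φ : ℝ → ℝ} {I : Set ℝ} {N : Set (ℝ × E)} {p : ℝ × E} {S : Set E} {b : E}

lemma IsPSubmanifold.exists_isLNEOn_polarMap (hN : IsPSubmanifold N) (hp : p ∈ N) (hp0 : p.1 = 0)
    (hφ : IsRadius φ I) (hS : MapsTo (polarMap φ b) (N ∩ Prod.fst ⁻¹' I) S) :
    ∃ C, ∃ U ∈ 𝓝 p, IsLNEOn S (polarMap φ b '' (N ∩ Prod.fst ⁻¹' I ∩ U)) C := by
  obtain ⟨K, U, hU, hcurves⟩ := hN.exists_section_and_slice_curve hp hp0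
  refine ⟨1 + 4 * K, U, hU, ?_⟩
  rintro _ ⟨x, ⟨⟨hxN, hxI⟩, hxU⟩, rfl⟩ _ ⟨y, ⟨⟨hyN, hyI⟩, hyU⟩, rfl⟩
  wlog hle : φ y.1 ≤ φ x.1 generalizing x y
  · rw [innerDist_comm, dist_comm]
    exact this y hyU hyN hyI x hxU hxN hxI (le_of_not_ge hle)
  obtain ⟨c, d, ⟨hc, hcx, hcN⟩, hd, hdc, hdy, hdN⟩ := hcurves x ⟨hxN, hxU⟩ y ⟨hyN, hyU⟩
  rw [uIcc_comm] at hc hcN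
  have hI : uIcc y.1 x.1 ⊆ I := hφ.ordConnected.uIcc_subset hyI hxI
  have hradial := hφ.innerDist_polarMap_section_le (S := S) (b := b) hyI hxI hle hc
    (fun r hr => (hN.1 _ (hcN r hr)).2) fun r hr => hS ⟨hcN r hr, hI hr⟩
  have hslice := innerDist_polarMap_slice_le (S := S) (b := b) (hφ.nonneg _ hyI) hd
    fun θ hθ => hS ⟨hdN θ hθ, hyI⟩
  rw [innerDist_comm, hcx] at hradial
  rw [hdc, hdy] at hslice
  refine (innerDist_le_ofReal_add (mul_nonneg (by positivity) (sub_nonneg.2 hle))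
    (mul_nonneg (hφ.nonneg _ hyI) (by positivity)) hradial hslice).trans
    (ENNReal.ofReal_le_ofReal ?_)
  have hradius : φ x.1 - φ y.1 ≤ dist (polarMap φ b x) (polarMap φ b y) := by
    rw [dist_polarMap]
    exact (le_abs_self _).trans (abs_sub_le_dist_smul (hφ.nonneg _ hxI) (hφ.nonneg _ hyI)
      (hN.1 x hxN).2 (hN.1 y hyN).2)
  have hangle : φ y.1 * dist x y ≤ 3 * dist (polarMap φ b x) (polarMap φ b y) :=
    calc φ y.1 * dist x y ≤ φ y.1 * (|y.1 - x.1| + dist y.2 x.2) := by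
          rw [dist_comm, Prod.dist_eq, Real.dist_eq]
          exact mul_le_mul_of_nonneg_left (max_le_add_of_nonneg (abs_nonneg _) dist_nonneg)
            (hφ.nonneg _ hyI)
      _ = φ y.1 * |y.1 - x.1| + φ y.1 * dist y.2 x.2 := mul_add _ _ _
      _ ≤ (φ x.1 - φ y.1) + 2 * dist (φ y.1 • y.2) (φ x.1 • x.2) :=
        add_le_add (hφ.mul_abs_sub_le _ hyI _ hxI hle) (mul_dist_le_two_mul_dist_smul
          (hφ.nonneg _ hyI) (hφ.nonneg _ hxI) (hN.1 y hyN).2 (hN.1 x hxN).2)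
      _ ≤ 3 * dist (polarMap φ b x) (polarMap φ b y) := by
        rw [← dist_polarMap φ b, dist_comm]
        linarith
  calc (1 + K) * (φ x.1 - φ y.1) + φ y.1 * (K * nndist x y : ℝ≥0)
      = (1 + K) * (φ x.1 - φ y.1) + K * (φ y.1 * dist x y) := by push_cast; ring
    _ ≤ (1 + K) * dist (polarMap φ b x) (polarMap φ b y)
        + K * (3 * dist (polarMap φ b x) (polarMap φ b y)) := by gcongr
    _ = (1 + 4 * K : ℝ≥0) * dist (polarMap φ b x) (polarMap φ b y) := by push_cast; ring

end LocalEstimate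

section Compactness

lemma exists_eventually_nhdsSet_of_monotone {M ι : Type*} [TopologicalSpace M] [Preorder ι]
    [IsDirectedOrder ι] [Nonempty ι] {K : Set M} (hK : IsCompact K) {Q : ι → M → Prop}
    (hQ : ∀ x, Monotone fun i => Q i x) (h : ∀ x ∈ K, ∃ i, ∀ᶠ y in 𝓝 x, Q i y) :
    ∃ i, ∀ᶠ y in 𝓝ˢ K, Q i y := by
  refine hK.induction_on (p := fun s => ∃ i, ∀ᶠ y in 𝓝ˢ s, Q i y) (by simp) ?_ ?_ ?_
  · exact fun s t hst ⟨i, hi⟩ => ⟨i, hi.filter_mono (nhdsSet_mono hst)⟩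
  · rintro s t ⟨i, hi⟩ ⟨j, hj⟩
    obtain ⟨k, hik, hjk⟩ := exists_ge_ge i j
    rw [nhdsSet_union]
    exact ⟨k, eventually_sup.2 ⟨hi.mono fun x => hQ x hik, hj.mono fun x => hQ x hjk⟩⟩
  · intro x hx
    obtain ⟨i, hi⟩ := h x hx
    obtain ⟨U, hU, hUo, hxU⟩ := eventually_nhds_iff.1 hi
    refine ⟨U, nhdsWithin_le_nhds (hUo.mem_nhds hxU), i, ?_⟩
    rwa [hUo.nhdsSet_eq, eventually_principal]

variable {M E : Type*} [TopologicalSpace M] [PseudoMetricSpace E] {S : Set E} {o : E} {F : M → E}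
  {Z K : Set M} {w : M → ℝ}

lemma exists_isLNEOn_image_of_prod (hK : IsCompact K)
    (hpair : ∀ p ∈ K, ∀ q ∈ K, ∃ C : ℝ≥0, ∀ᶠ z in 𝓝 (p, q), z.1 ∈ Z → z.2 ∈ Z →
      innerDist S (F z.1) (F z.2) ≤ ENNReal.ofReal (C * dist (F z.1) (F z.2))) :
    ∃ C, ∃ T ∈ 𝓝ˢ K, IsLNEOn S (F '' (Z ∩ T)) C := by
  obtain ⟨C, hC⟩ := exists_eventually_nhdsSet_of_monotone (hK.prod hK)
    (Q := fun (C : ℝ≥0) z => z.1 ∈ Z → z.2 ∈ Z →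
      innerDist S (F z.1) (F z.2) ≤ ENNReal.ofReal (C * dist (F z.1) (F z.2)))
    (fun z C D hCD h h₁ h₂ => (h h₁ h₂).trans (ENNReal.ofReal_le_ofReal (by gcongr)))
    fun z hz => hpair z.1 hz.1 z.2 hz.2
  rw [hK.nhdsSet_prod_eq hK] at hC
  obtain ⟨T, hT, hTC⟩ := eventually_prod_self_iff'.1 hC
  refine ⟨C, T, hT, ?_⟩
  rintro _ ⟨x, ⟨hxZ, hxT⟩, rfl⟩ _ ⟨y, ⟨hyZ, hyT⟩, rfl⟩
  exact hTC x hxT y hyT hxZ hyZ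

/- Two points tending to the same point of `K` are joined locally, two points tending to distinct
points of `K` are joined through `o`. -/
lemma exists_isLNEOn_image_of_isCompact (hK : IsCompact K) (hw : ∀ x ∈ Z, 0 ≤ w x)
    (hloc : ∀ p ∈ K, ∃ C, ∃ U ∈ 𝓝 p, IsLNEOn S (F '' (Z ∩ U)) C)
    (hrad : ∀ p ∈ K, ∃ C : ℝ≥0, ∀ᶠ x in 𝓝 p, x ∈ Z →
      innerDist S o (F x) ≤ ENNReal.ofReal (C * w x))
    (hsep : ∀ p ∈ K, ∀ q ∈ K, p ≠ q → ∃ c : ℝ≥0, ∀ᶠ z in 𝓝 (p, q), z.1 ∈ Z → z.2 ∈ Z →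
      w z.1 + w z.2 ≤ c * dist (F z.1) (F z.2)) :
    ∃ C, ∃ T ∈ 𝓝ˢ K, IsLNEOn S (F '' (Z ∩ T)) C := by
  refine exists_isLNEOn_image_of_prod hK fun p hp q hq => ?_
  obtain rfl | hpq := eq_or_ne p q
  · obtain ⟨C, U, hU, hC⟩ := hloc p hp
    refine ⟨C, ?_⟩
    filter_upwards [prod_mem_nhds hU hU] with z hz hz₁ hz₂
    exact hC _ (mem_image_of_mem F ⟨hz₁, hz.1⟩) _ (mem_image_of_mem F ⟨hz₂, hz.2⟩)
  · obtain ⟨A, hA⟩ := hrad p hp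
    obtain ⟨B, hB⟩ := hrad q hq
    obtain ⟨c, hc⟩ := hsep p hp q hq hpq
    refine ⟨max A B * c, ?_⟩
    filter_upwards [hc, hA.prod_inl_nhds q, hB.prod_inr_nhds p] with z hz hzA hzB hz₁ hz₂
    have hw₁ := hw _ hz₁
    have hw₂ := hw _ hz₂
    have hzo : innerDist S (F z.1) o ≤ ENNReal.ofReal (A * w z.1) := by
      rw [innerDist_comm]
      exact hzA hz₁
    refine (innerDist_le_ofReal_add (by positivity) (by positivity) hzo (hzB hz₂)).trans
      (ENNReal.ofReal_le_ofReal ?_)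
    calc A * w z.1 + B * w z.2 ≤ (max A B : ℝ≥0) * w z.1 + (max A B : ℝ≥0) * w z.2 := by
          gcongr
          exacts [le_max_left A B, le_max_right A B]
      _ = (max A B : ℝ≥0) * (w z.1 + w z.2) := (mul_add _ _ _).symm
      _ ≤ (max A B : ℝ≥0) * (c * dist (F z.1) (F z.2)) := by
          gcongr
          exact hz hz₁ hz₂
      _ = (max A B * c : ℝ≥0) * dist (F z.1) (F z.2) := by rw [NNReal.coe_mul, mul_assoc]

end Compactness

section Finiteness

variable {E : Type*} [PseudoMetricSpace E] {X A : Set E} {o : E} {C : ℝ≥0}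

lemma IsLNEOn.innerDist_ne_top {x y : E} (h : IsLNEOn X A C) (hx : x ∈ A) (hy : y ∈ A) :
    innerDist X x y ≠ ⊤ :=
  ((h x hx y hy).trans_lt ENNReal.ofReal_lt_top).ne

lemma innerDist_ne_top_of_isPreconnected (hconn : IsPreconnected X)
    (hloc : ∀ a ∈ X, IsLNEAt X a) : ∀ x ∈ X, ∀ y ∈ X, innerDist X x y ≠ ⊤ := by
  intro x hx y hy
  refine hconn.induction₂ (fun x y => innerDist X x y ≠ ⊤) ?_ ?_ ?_ hx hy
  · intro a ha
    obtain ⟨C, U, hU, hC⟩ := hloc a ha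
    filter_upwards [nhdsWithin_le_nhds hU, self_mem_nhdsWithin] with y hyU hyX
    exact hC.innerDist_ne_top ⟨ha, mem_of_mem_nhds hU⟩ ⟨hyX, hyU⟩
  · exact fun x y z _ _ _ hxy hyz =>
      ne_top_of_le_ne_top (ENNReal.add_ne_top.2 ⟨hxy, hyz⟩) (innerDist_triangle X x y z)
  · intro x y _ _ hxy
    rwa [innerDist_comm]

lemma IsLNEOn.exists_innerDist_le_mul_one_add_dist (h : IsLNEOn X A C)
    (hfin : ∀ x ∈ A, innerDist X o x ≠ ⊤) :
    ∃ B : ℝ≥0, ∀ x ∈ A, innerDist X o x ≤ ENNReal.ofReal (B * (1 + dist o x)) := by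
  obtain rfl | ⟨x₀, hx₀⟩ := A.eq_empty_or_nonempty
  · simp
  · let D : ℝ≥0 := (innerDist X o x₀).toNNReal
    have hD : innerDist X o x₀ ≤ ENNReal.ofReal D := by
      rw [ENNReal.ofReal_coe_nnreal, ENNReal.coe_toNNReal (hfin x₀ hx₀)]
    refine ⟨D + C * nndist o x₀ + C, fun x hx => ?_⟩
    refine (innerDist_le_ofReal_add D.coe_nonneg (by positivity) hD (h x₀ hx₀ x hx)).trans
      (ENNReal.ofReal_le_ofReal ?_)
    have htri : dist x₀ x ≤ dist o x₀ + dist o x := dist_triangle_left x₀ x o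
    push_cast
    calc D + C * dist x₀ x ≤ D + C * (dist o x₀ + dist o x) := by gcongr
      _ ≤ (D + C * dist o x₀ + C) * (1 + dist o x) := by
        have : 0 ≤ (D + C * dist o x₀) * dist o x + C := by positivity
        linarith

lemma IsLNEOn.isLNE_of_compl_closedBall {B : ℝ≥0} {R : ℝ} (hR : 1 ≤ R) (ho : o ∈ X)
    (hin : IsLNEOn X (X ∩ Metric.closedBall o (2 * R)) C)
    (hout : IsLNEOn X (X \ Metric.closedBall o R) B)
    (hfin : ∀ x ∈ X, innerDist X o x ≠ ⊤) : IsLNE X := by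
  obtain ⟨D, hD⟩ := hout.exists_innerDist_le_mul_one_add_dist fun x hx => hfin x hx.1
  refine IsLNEOn.isLNE (C := C + B + 3 * D) fun x hx y hy => ?_
  wlog hle : dist o x ≤ dist o y generalizing x y
  · rw [innerDist_comm, dist_comm]
    exact this y hy x hx (le_of_not_ge hle)
  by_cases hyR : dist o y ≤ 2 * R
  · exact hin.mono subset_rfl (by rw [add_assoc]; exact le_self_add) x
      ⟨hx, Metric.mem_closedBall'.2 (hle.trans hyR)⟩ y ⟨hy, Metric.mem_closedBall'.2 hyR⟩
  have hyB : y ∈ X \ Metric.closedBall o R :=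
    ⟨hy, fun h => hyR (by linarith [Metric.mem_closedBall'.1 h])⟩
  by_cases hxR : dist o x ≤ R
  · have hxo : innerDist X x o ≤ ENNReal.ofReal (C * dist o x) := by
      rw [dist_comm]
      exact hin x ⟨hx, Metric.mem_closedBall'.2 (by linarith)⟩ o
        ⟨ho, Metric.mem_closedBall_self (by linarith)⟩
    refine (innerDist_le_ofReal_add (by positivity) (by positivity) hxo (hD y hyB)).trans
      (ENNReal.ofReal_le_ofReal ?_)
    have htri : dist o y ≤ dist o x + dist x y := dist_triangle o x y
    push_cast
    calc C * dist o x + D * (1 + dist o y) ≤ C * dist x y + D * (3 * dist x y) := by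
          gcongr <;> linarith
      _ ≤ (C + B + 3 * D) * dist x y := by
        have : 0 ≤ B * dist x y := by positivity
        linarith
  · exact hout.mono subset_rfl (by rw [add_comm C, add_assoc]; exact le_self_add) x
      ⟨hx, fun h => hxR (Metric.mem_closedBall'.1 h)⟩ y hyB

end Finiteness

section CompactSubsets

variable {E : Type*} [MetricSpace E] {X K : Set E}

lemma exists_isLNEOn_of_isCompact (hK : IsCompact K) (hKX : K ⊆ X) (hloc : ∀ a ∈ K, IsLNEAt X a)
    (hfin : ∀ x ∈ X, ∀ y ∈ X, innerDist X x y ≠ ⊤) : ∃ C, IsLNEOn X K C := by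
  obtain rfl | ⟨o, ho⟩ := K.eq_empty_or_nonempty
  · exact ⟨0, by simp [IsLNEOn]⟩
  have hrad : ∀ a ∈ K, ∃ C : ℝ≥0, ∀ᶠ x in 𝓝 a, x ∈ X →
      innerDist X o (id x) ≤ ENNReal.ofReal (C * (1 + dist o x)) := by
    intro a ha
    obtain ⟨C, U, hU, hC⟩ := hloc a ha
    obtain ⟨B, hB⟩ := hC.exists_innerDist_le_mul_one_add_dist fun x hx => hfin o (hKX ho) x hx.1
    refine ⟨B, ?_⟩
    filter_upwards [hU] with x hxU hxX
    exact hB x ⟨hxX, hxU⟩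
  have hsep : ∀ a ∈ K, ∀ b ∈ K, a ≠ b → ∃ c : ℝ≥0, ∀ᶠ z in 𝓝 (a, b), z.1 ∈ X → z.2 ∈ X →
      1 + dist o z.1 + (1 + dist o z.2) ≤ c * dist (id z.1) (id z.2) := by
    intro a _ b _ hab
    let f (z : E × E) : ℝ := (1 + dist o z.1 + (1 + dist o z.2)) / dist z.1 z.2
    have hf : ContinuousAt f (a, b) :=
      ContinuousAt.div (by fun_prop) (by fun_prop) (dist_ne_zero.2 hab)
    have hfar : ∀ᶠ z : E × E in 𝓝 (a, b), 0 < dist z.1 z.2 :=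
      continuous_dist.continuousAt.eventually_const_lt (dist_pos.2 hab)
    refine ⟨(f (a, b) + 1).toNNReal, ?_⟩
    filter_upwards [hf.eventually_lt_const (lt_add_one _), hfar] with z hz hz0 _ _
    exact (div_le_iff₀ hz0).1 (hz.le.trans (Real.le_coe_toNNReal _))
  obtain ⟨C, T, hT, hC⟩ := exists_isLNEOn_image_of_isCompact hK (fun x _ => by positivity)
    (fun a ha => by simpa only [image_id, IsLNEAt] using hloc a ha) hrad hsep
  refine ⟨C, hC.mono ?_ le_rfl⟩
  rw [image_id]
  exact subset_inter hKX (subset_of_mem_nhdsSet hT)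

end CompactSubsets

section Ends

variable {E : Type*} [NormedAddCommGroup E]

lemma exists_inter_fst_lt_subset_of_mem_nhdsSet [NormedSpace ℝ E] [FiniteDimensional ℝ E]
    {Z T : Set (ℝ × E)} (hZ : IsClosed Z) (hZM : ∀ p ∈ Z, 0 ≤ p.1 ∧ ‖p.2‖ = 1)
    (hT : T ∈ 𝓝ˢ (Z ∩ {p | p.1 = 0})) : ∃ m > 0, Z ∩ {p | p.1 < m} ⊆ T := by
  have : ProperSpace E := FiniteDimensional.proper ℝ E
  obtain ⟨U, hU, hKU, hUT⟩ := mem_nhdsSet_iff_exists.1 hT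
  let K : Set (ℝ × E) := Icc 0 1 ×ˢ Metric.sphere 0 1 ∩ (Z \ U)
  have hK : IsCompact (Prod.fst '' K) := (((isCompact_Icc.prod (isCompact_sphere 0 1)).inter_right
    (hZ.sdiff hU)).image continuous_fst)
  have h0 : (0 : ℝ) ∉ Prod.fst '' K := by
    rintro ⟨p, ⟨-, hpZ, hpU⟩, hp0⟩
    exact hpU (hKU ⟨hpZ, hp0⟩)
  obtain ⟨m, hm, hmK⟩ := Metric.isOpen_iff.1 hK.isClosed.isOpen_compl 0 h0
  refine ⟨min m 1, lt_min hm one_pos, fun p ⟨hpZ, hpm⟩ => hUT ?_⟩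
  obtain ⟨hp0, hp1⟩ := hZM p hpZ
  obtain ⟨hpm, hpm1⟩ := lt_min_iff.1 (show p.1 < min m 1 from hpm)
  by_contra hpU
  have hpm0 : p.1 ∈ Metric.ball 0 m := by rwa [mem_ball_zero_iff, Real.norm_of_nonneg hp0]
  exact hmK hpm0 ⟨p, ⟨⟨⟨hp0, hpm1.le⟩, by simpa using hp1⟩, hpZ, hpU⟩, rfl⟩

lemma eventually_add_le_mul_dist_polarMap [NormedSpace ℝ E] {φ : ℝ → ℝ} {b : E} {p q : ℝ × E}
    (hpq : p.2 ≠ q.2) : ∃ c : ℝ≥0, ∀ᶠ z in 𝓝 (p, q),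
      0 ≤ φ z.1.1 → 0 ≤ φ z.2.1 → ‖z.1.2‖ = 1 → ‖z.2.2‖ = 1 →
        φ z.1.1 + φ z.2.1 ≤ c * dist (polarMap φ b z.1) (polarMap φ b z.2) := by
  have hη : 0 < dist p.2 q.2 / 2 := half_pos (dist_pos.2 hpq)
  have hcont : ContinuousAt (fun z : (ℝ × E) × (ℝ × E) => dist z.1.2 z.2.2) (p, q) := by fun_prop
  refine ⟨(4 / (dist p.2 q.2 / 2)).toNNReal, ?_⟩
  filter_upwards [hcont.eventually_const_lt (half_lt_self (dist_pos.2 hpq))] with ⟨x, y⟩ hη' hx hy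
    hx1 hy1
  dsimp only at hη' hx hy hx1 hy1 ⊢
  rw [dist_polarMap, Real.coe_toNNReal _ (by positivity), div_mul_eq_mul_div, le_div_iff₀ hη]
  have hx' := mul_dist_le_two_mul_dist_smul hx hy hx1 hy1
  have hy' := mul_dist_le_two_mul_dist_smul hy hx hy1 hx1
  rw [dist_comm, dist_comm (φ y.1 • y.2)] at hy'
  calc (φ x.1 + φ y.1) * (dist p.2 q.2 / 2) ≤ (φ x.1 + φ y.1) * dist x.2 y.2 := by gcongr
    _ = φ x.1 * dist x.2 y.2 + φ y.1 * dist x.2 y.2 := add_mul _ _ _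
    _ ≤ 4 * dist (φ x.1 • x.2) (φ y.1 • y.2) := by rw [dist_comm x.2 y.2] at *; linarith

variable [InnerProductSpace ℝ E] [FiniteDimensional ℝ E] {φ : ℝ → ℝ} {I : Set ℝ}
  {Z W : Set (ℝ × E)} {S : Set E} {b o : E}

lemma IsPSubmanifold.exists_isLNEOn_end (hφ : IsRadius φ I) (hZ : IsClosed Z)
    (hZM : ∀ p ∈ Z, 0 ≤ p.1 ∧ ‖p.2‖ = 1) (hW : IsOpen W) (hZW : Z ∩ {p | p.1 = 0} ⊆ W)
    (hN : IsPSubmanifold (Z ∩ W)) (hS : MapsTo (polarMap φ b) (Z ∩ W ∩ Prod.fst ⁻¹' I) S)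
    (hrad : ∀ p ∈ Z, p.1 = 0 → ∃ B : ℝ≥0, ∀ᶠ x in 𝓝 p, x ∈ Z ∩ W ∩ Prod.fst ⁻¹' I →
      innerDist S o (polarMap φ b x) ≤ ENNReal.ofReal (B * φ x.1)) :
    ∃ m > 0, ∃ C, IsLNEOn S (polarMap φ b '' (Z ∩ Prod.fst ⁻¹' I ∩ {p | p.1 < m})) C := by
  have : ProperSpace E := FiniteDimensional.proper ℝ E
  have hK : IsCompact (Z ∩ {p | p.1 = 0}) :=
    (isCompact_singleton.prod (isCompact_sphere (0 : E) 1)).of_isClosed_subset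
      (s := {(0 : ℝ)} ×ˢ Metric.sphere 0 1) (hZ.inter (isClosed_eq continuous_fst continuous_const))
      fun p hp => ⟨hp.2, by simpa using (hZM p hp.1).2⟩
  have hsep : ∀ p ∈ Z ∩ {p | p.1 = 0}, ∀ q ∈ Z ∩ {p | p.1 = 0}, p ≠ q → ∃ c : ℝ≥0,
      ∀ᶠ z in 𝓝 (p, q), z.1 ∈ Z ∩ W ∩ Prod.fst ⁻¹' I → z.2 ∈ Z ∩ W ∩ Prod.fst ⁻¹' I →
        φ z.1.1 + φ z.2.1 ≤ c * dist (polarMap φ b z.1) (polarMap φ b z.2) := by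
    intro p hp q hq hpq
    have hdir : p.2 ≠ q.2 := fun h => hpq (Prod.ext (hp.2.trans hq.2.symm) h)
    obtain ⟨c, hc⟩ := eventually_add_le_mul_dist_polarMap (φ := φ) (b := b) hdir
    refine ⟨c, ?_⟩
    filter_upwards [hc] with z hz hx hy
    exact hz (hφ.nonneg _ hx.2) (hφ.nonneg _ hy.2) (hN.1 _ hx.1).2 (hN.1 _ hy.1).2
  obtain ⟨C, T, hT, hC⟩ := exists_isLNEOn_image_of_isCompact hK (fun x hx => hφ.nonneg _ hx.2)
    (fun p hp => hN.exists_isLNEOn_polarMap ⟨hp.1, hZW hp⟩ hp.2 hφ hS)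
    (fun p hp => hrad p hp.1 hp.2) hsep
  obtain ⟨m, hm, hmT⟩ := exists_inter_fst_lt_subset_of_mem_nhdsSet hZ hZM
    (inter_mem (hW.mem_nhdsSet.2 hZW) hT)
  refine ⟨m, hm, C, hC.mono (image_mono ?_) le_rfl⟩
  rintro p ⟨⟨hpZ, hpI⟩, hpm⟩
  obtain ⟨hpW, hpT⟩ := hmT ⟨hpZ, hpm⟩
  exact ⟨⟨⟨hpZ, hpW⟩, hpI⟩, hpT⟩

end Ends

section ConicPoint

variable {E : Type*} [NormedAddCommGroup E]

lemma nonneg_and_norm_eq_one_of_mem_closure {A : Set (ℝ × E)}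
    (hA : ∀ p ∈ A, 0 < p.1 ∧ ‖p.2‖ = 1) : ∀ p ∈ closure A, 0 ≤ p.1 ∧ ‖p.2‖ = 1 :=
  closure_minimal (fun p hp => ⟨(hA p hp).1.le, (hA p hp).2⟩)
    ((isClosed_le continuous_const continuous_fst).inter
      (isClosed_eq continuous_snd.norm continuous_const))

variable [InnerProductSpace ℝ E] {X S : Set E} {a x : E} {N : Set (ℝ × E)} {p : ℝ × E}

lemma strictTransform_nonneg_and_norm_eq_one :
    ∀ p ∈ strictTransform S a, 0 ≤ p.1 ∧ ‖p.2‖ = 1 :=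
  nonneg_and_norm_eq_one_of_mem_closure fun _ hp => ⟨hp.1, hp.2.1⟩

lemma mem_strictTransform_of_mem (hx : x ∈ S) (hxa : x ≠ a) :
    (‖x - a‖, ‖x - a‖⁻¹ • (x - a)) ∈ strictTransform S a := by
  refine subset_closure ⟨norm_pos_iff.2 (sub_ne_zero.2 hxa),
    norm_smul_inv_norm (𝕜 := ℝ) (sub_ne_zero.2 hxa), ?_⟩
  have hpolar := polarMap_norm_sub (φ := id) (fun _ => rfl) hxa
  rw [polarMap] at hpolar
  exact hpolar.symm ▸ hx

lemma polarMap_mem_of_mem_strictTransform {ε r : ℝ} (hX : IsClosed (X ∩ Metric.closedBall a ε))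
    (hp : p ∈ strictTransform (X ∩ Metric.ball a r) a) (hpε : p.1 < ε) : polarMap id a p ∈ X := by
  have hpc := (isOpen_lt continuous_fst continuous_const).inter_closure (⟨hpε, hp⟩ :
    p ∈ {q : ℝ × E | q.1 < ε} ∩ closure _)
  have hcont : Continuous (polarMap id a) := by unfold polarMap; fun_prop
  refine (closure_minimal (fun q hq => ?_) (hX.preimage hcont) hpc).1
  obtain ⟨hqε, hq0, hq1, hqX, -⟩ := hq
  refine ⟨hqX, ?_⟩
  rw [Metric.mem_closedBall', dist_polarMap_center a hq0.le hq1]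
  exact le_of_lt hqε

variable [FiniteDimensional ℝ E]

lemma IsPSubmanifold.exists_innerDist_polarMap_id_le {c : ℝ} (hN : IsPSubmanifold N) (hp : p ∈ N)
    (hp0 : p.1 = 0) (hc0 : 0 ≤ c) (hc1 : c ≤ 1)
    (hS : MapsTo (polarMap id a) (N ∩ Prod.fst ⁻¹' Icc 0 c) S) :
    ∃ B : ℝ≥0, ∀ᶠ x in 𝓝 p, x ∈ N ∩ Prod.fst ⁻¹' Icc 0 c →
      innerDist S a (polarMap id a x) ≤ ENNReal.ofReal (B * x.1) := by
  obtain ⟨C, U, hU, hC⟩ := hN.exists_isLNEOn_polarMap hp hp0 (isRadius_id hc1) hS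
  refine ⟨C, ?_⟩
  filter_upwards [hU] with x hxU hx
  have hapex : polarMap id a p = a := by simp [polarMap, hp0]
  have ha := hC (polarMap id a p) ⟨p, ⟨⟨hp, by simp [hp0, hc0]⟩, mem_of_mem_nhds hU⟩, rfl⟩
    (polarMap id a x) ⟨x, ⟨hx, hxU⟩, rfl⟩
  rwa [hapex, dist_polarMap_center a hx.2.1 (hN.1 x hx.1).2] at ha

lemma IsConicPoint.isLNEAt (ha : IsConicPoint X a) : IsLNEAt X a := by
  obtain ⟨haX, ⟨ε, hε, hX⟩, r, hr, hN⟩ := ha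
  set Z := strictTransform (X ∩ Metric.ball a r) a
  have hZ : IsClosed Z := isClosed_closure
  have hZM : ∀ p ∈ Z, 0 ≤ p.1 ∧ ‖p.2‖ = 1 := strictTransform_nonneg_and_norm_eq_one
  obtain ⟨c, hc, hcε⟩ := exists_between (lt_min one_pos hε)
  obtain ⟨hc1, hcε⟩ := lt_min_iff.1 hcε
  have hS : MapsTo (polarMap id a) (Z ∩ {p | p.1 < r} ∩ Prod.fst ⁻¹' Icc 0 c) X :=
    fun p hp => polarMap_mem_of_mem_strictTransform hX hp.1.1 (hp.2.2.trans_lt hcε)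
  have hpolar : ∀ x ∈ X ∩ Metric.ball a r, x ≠ a → (‖x - a‖, ‖x - a‖⁻¹ • (x - a)) ∈ Z :=
    fun x hx hxa => mem_strictTransform_of_mem hx hxa
  by_cases hK : ∃ p ∈ Z, p.1 = 0
  · obtain ⟨p, hp, hp0⟩ := hK
    obtain ⟨m, hm, C, hC⟩ := hN.exists_isLNEOn_end (isRadius_id hc1.le) hZ hZM
      (isOpen_lt continuous_fst continuous_const) (fun p hp => hp.2.trans_lt hr) hS
      fun p hp hp0 => hN.exists_innerDist_polarMap_id_le ⟨hp, hp0.trans_lt hr⟩ hp0 hc.le hc1.le hS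
    refine ⟨C, Metric.ball a (min r (min c m)),
      Metric.ball_mem_nhds a (lt_min hr (lt_min hc hm)), hC.mono ?_ le_rfl⟩
    rintro x ⟨hxX, hxa⟩
    rw [Metric.mem_ball, dist_eq_norm, lt_min_iff, lt_min_iff] at hxa
    obtain ⟨hxr, hxc, hxm⟩ := hxa
    obtain rfl | hne := eq_or_ne x a
    · exact ⟨p, ⟨⟨hp, by simp [hp0, hc.le]⟩, hp0.trans_lt hm⟩, by simp [polarMap, hp0]⟩
    · exact ⟨_, ⟨⟨hpolar x ⟨hxX, mem_ball_iff_norm.2 hxr⟩ hne, norm_nonneg _, hxc.le⟩, hxm⟩,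
        polarMap_norm_sub (fun _ => rfl) hne⟩
  · have hempty : Z ∩ {p | p.1 = 0} = ∅ := eq_empty_of_forall_notMem fun p hp => hK ⟨p, hp⟩
    obtain ⟨m, hm, hmZ⟩ := exists_inter_fst_lt_subset_of_mem_nhdsSet (T := ∅) hZ hZM
      (by rw [hempty, nhdsSet_empty]; exact mem_bot)
    refine ⟨0, Metric.ball a (min r m), Metric.ball_mem_nhds a (lt_min hr hm),
      (isLNEOn_singleton haX 0).mono ?_ le_rfl⟩
    rintro x ⟨hxX, hxa⟩
    rw [Metric.mem_ball, dist_eq_norm, lt_min_iff] at hxa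
    by_contra hne
    exact hmZ ⟨hpolar x ⟨hxX, mem_ball_iff_norm.2 hxa.1⟩ hne, hxa.2⟩

end ConicPoint

section Infinity

variable {E : Type*} [NormedAddCommGroup E] [InnerProductSpace ℝ E] {X S : Set E} {o x : E}
  {N : Set (ℝ × E)} {p : ℝ × E}

lemma closureAtInfinity_nonneg_and_norm_eq_one :
    ∀ p ∈ closureAtInfinity X, 0 ≤ p.1 ∧ ‖p.2‖ = 1 :=
  nonneg_and_norm_eq_one_of_mem_closure fun _ hp => ⟨hp.1, hp.2.1⟩

lemma mem_closureAtInfinity_of_mem (hx : x ∈ X) (hx0 : x ≠ 0) :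
    (‖x‖⁻¹, ‖x‖⁻¹ • x) ∈ closureAtInfinity X := by
  refine subset_closure ⟨inv_pos.2 (norm_pos_iff.2 hx0), norm_smul_inv_norm (𝕜 := ℝ) hx0, ?_⟩
  rwa [inv_inv, smul_inv_smul₀ (norm_ne_zero_iff.2 hx0)]

lemma polarMap_mem_of_mem_closureAtInfinity (hX : IsClosed X) (hp : p ∈ closureAtInfinity X)
    (hp0 : p.1 ≠ 0) : polarMap (fun t => t⁻¹) 0 p ∈ X := by
  have hcont : ContinuousAt (polarMap (fun t => t⁻¹) (0 : E)) p :=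
    continuousAt_const.add ((continuousAt_fst.inv₀ hp0).smul continuousAt_snd)
  refine closure_minimal ?_ hX (mem_closure_image hcont hp)
  rintro _ ⟨q, hq, rfl⟩
  rw [polarMap, zero_add]
  exact hq.2.2

variable [FiniteDimensional ℝ E]

lemma IsPSubmanifold.exists_innerDist_polarMap_inv_le (hN : IsPSubmanifold N) (hp : p ∈ N)
    (hp0 : p.1 = 0) (hS : MapsTo (polarMap (fun t => t⁻¹) 0) (N ∩ Prod.fst ⁻¹' Ioc 0 1) S)
    (hfin : ∀ x ∈ S, innerDist S o x ≠ ⊤) :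
    ∃ B : ℝ≥0, ∀ᶠ x in 𝓝 p, x ∈ N ∩ Prod.fst ⁻¹' Ioc 0 1 →
      innerDist S o (polarMap (fun t => t⁻¹) 0 x) ≤ ENNReal.ofReal (B * x.1⁻¹) := by
  obtain ⟨C, U, hU, hC⟩ := hN.exists_isLNEOn_polarMap hp hp0 isRadius_inv hS
  obtain ⟨B, hB⟩ := hC.exists_innerDist_le_mul_one_add_dist
    (forall_mem_image.2 fun x hx => hfin _ (hS hx.1))
  refine ⟨B * (2 + ‖o‖₊), ?_⟩
  filter_upwards [hU] with x hxU hx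
  refine (hB _ ⟨x, ⟨hx, hxU⟩, rfl⟩).trans (ENNReal.ofReal_le_ofReal ?_)
  have hx1 : 1 ≤ x.1⁻¹ := (one_le_inv₀ hx.2.1).2 hx.2.2
  have hdist : dist o (polarMap (fun t => t⁻¹) 0 x) ≤ ‖o‖ + x.1⁻¹ :=
    calc _ ≤ dist o 0 + dist 0 (polarMap (fun t => t⁻¹) 0 x) := dist_triangle _ _ _
      _ = ‖o‖ + x.1⁻¹ := by
        rw [dist_zero_right, dist_polarMap_center 0 (inv_nonneg.2 hx.2.1.le) (hN.1 x hx.1).2]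
  push_cast
  calc B * (1 + dist o (polarMap (fun t => t⁻¹) 0 x)) ≤ B * (1 + (‖o‖ + x.1⁻¹)) := by gcongr
    _ ≤ B * ((2 + ‖o‖) * x.1⁻¹) := by
      gcongr
      linarith [le_mul_of_one_le_right (norm_nonneg o) hx1]
    _ = B * (2 + ‖o‖) * x.1⁻¹ := (mul_assoc _ _ _).symm

lemma IsConicAtInfinity.exists_isLNEOn_compl_closedBall (h : IsConicAtInfinity X)
    (hX : IsClosed X) (hfin : ∀ x ∈ X, innerDist X o x ≠ ⊤) :
    ∃ R B, 1 ≤ R ∧ IsLNEOn X (X \ Metric.closedBall o R) B := by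
  obtain hb | ⟨-, W, hW, hXW, hN⟩ := h
  · obtain ⟨R, hR, hXR⟩ := hb.subset_closedBall_lt 1 o
    exact ⟨R, 0, hR.le, by simp [IsLNEOn, sdiff_eq_empty.2 hXR]⟩
  have hZW : closureAtInfinity X ∩ {p | p.1 = 0} ⊆ W := by
    rintro ⟨_, u⟩ ⟨hp, rfl⟩
    exact hXW ⟨rfl, hp⟩
  have hS : MapsTo (polarMap (fun t => t⁻¹) 0)
      (closureAtInfinity X ∩ W ∩ Prod.fst ⁻¹' Ioc 0 1) X :=
    fun p hp => polarMap_mem_of_mem_closureAtInfinity hX hp.1.1 hp.2.1.ne'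
  obtain ⟨m, hm, C, hC⟩ := hN.exists_isLNEOn_end isRadius_inv isClosed_closure
    closureAtInfinity_nonneg_and_norm_eq_one hW hZW hS
    fun p hp hp0 => hN.exists_innerDist_polarMap_inv_le ⟨hp, hZW ⟨hp, hp0⟩⟩ hp0 hS hfin
  have hm' : 0 < m⁻¹ := inv_pos.2 hm
  refine ⟨1 + m⁻¹ + ‖o‖, C, by linarith [norm_nonneg o], hC.mono ?_ le_rfl⟩
  rintro x ⟨hxX, hxo⟩
  have hx : 1 + m⁻¹ < ‖x‖ := by
    have htri := dist_le_norm_add_norm x o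
    rw [Metric.mem_closedBall, not_le] at hxo
    linarith
  have hx0 : x ≠ 0 := norm_pos_iff.1 (by linarith)
  refine ⟨_, ⟨⟨mem_closureAtInfinity_of_mem hxX hx0, inv_pos.2 (norm_pos_iff.2 hx0),
    inv_le_one_of_one_le₀ (by linarith)⟩, inv_lt_of_inv_lt₀ hm (by linarith)⟩, ?_⟩
  simpa only [sub_zero] using polarMap_norm_sub inv_involutive hx0

end Infinity

end ConicLNE

theorem theorem3p9_general {E : Type*} [NormedAddCommGroup E] [InnerProductSpace ℝ E]
    [FiniteDimensional ℝ E] {X : Set E} (hclosed : IsClosed X)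
    (hconic : ∀ a ∈ ConicLNE.singularLocus X, ConicLNE.IsConicPoint X a)
    (hinf : ConicLNE.IsConicAtInfinity X) (hconn : IsPreconnected X) : ConicLNE.IsLNE X := by
  have : ProperSpace E := FiniteDimensional.proper ℝ E
  obtain rfl | ⟨o, ho⟩ := X.eq_empty_or_nonempty
  · exact ⟨1, one_pos, by simp⟩
  have hloc : ∀ a ∈ X, ConicLNE.IsLNEAt X a := fun a ha =>
    (em (ConicLNE.IsSmoothPoint X a)).elim (fun hs => hs.isLNEAt) fun hs =>
      (hconic a ⟨ha, hs⟩).isLNEAt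
  have hfin := ConicLNE.innerDist_ne_top_of_isPreconnected hconn hloc
  obtain ⟨R, B, hR, hout⟩ := hinf.exists_isLNEOn_compl_closedBall hclosed (hfin o ho)
  obtain ⟨C, hin⟩ := ConicLNE.exists_isLNEOn_of_isCompact
    ((isCompact_closedBall o (2 * R)).inter_left hclosed) Set.inter_subset_left
    (fun a ha => hloc a ha.1) hfin
  exact hin.isLNE_of_compl_closedBall hR ho hout (hfin o ho)

theorem theorem3p9 (n : ℕ) (X : Set (EuclideanSpace ℝ (Fin n)))
    (hX : ConicLNE.IsConicSingularSubmanifold X) (hconn : IsConnected X) :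
    ConicLNE.IsLNE X :=
  theorem3p9_general hX.isClosed hX.conic_of_singular hX.conic_at_infinity hconn.isPreconnected
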